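/- Setting. Agents $1,\dots,m$ are the nodes of an undirected graph $\mathcal G$ without self-loops; $\mathcal N_i$ is the set of neighbours of $i$. Agent $i$ holds a convex function $f_i:\mathbb R^d\to\mathbb R$ that is $L_f$-smooth (differentiable with $L_f$-Lipschitz gradient). For $\mathbf x=[x_1,\dots,x_m]^\top\in\mathbb R^{m\times d}$, with the Frobenius norm and inner product, put $f(\mathbf x)=\sum_i f_i(x_i)$ and $\nabla f(\mathbf x)=[\nabla f_1(x_1),\dots,\nabla f_m(x_m)]^\top$. Let $\mathbf x^\star$ be a solution of $\min f(\mathbf x)$ over the consensus space $\mathcal C=\{\mathbf 1x^\top: x\in\mathbb R^d\}$, and let $G(\mathbf x)=f(\mathbf x)-f(\mathbf x^\star)-\langle\nabla f(\mathbf x^\star),\mathbf x-\mathbf x^\star\rangle$ be the Bregman distance. A gossip matrix for $\mathcal G$ is a symmetric positive semidefinite $\Lambda\in\mathbb R^{m\times m}$ with $\Lambda_{ij}=0$ whenever $i\ne j$ and $\{i,j\}$ is not an edge, and with null space spanned by $\mathbf 1$; its eigengap is $\lambda_2/\lambda_m$, where $0=\lambda_1\le\lambda_2\le\dots\le\lambda_m$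 are its eigenvalues. A gradient evaluation takes time $1$, a communication between neighbours takes time $\tau_c>0$. An algorithm in the class $\mathcal A$ on $\mathcal G$ produces $\mathbf x^{(t)}\in\mathbb R^{m\times d}$, $t\ge 0$, with $\mathbf x^{(0)}=0$ and, for all $t\ge0$ and all $i$, $$x_i^{(t)}\in\operatorname{span}\{x_j^{(s)}: j\in\mathcal N_i,\ 0\le s<t-\tau_c\}+\operatorname{span}\{x_i^{(s)},\nabla f_i(x_i^{(s)}): 0\le s<t-1\}.$$ Claim. There are absolute constants $c_0,c,C>0$ such that the following holds. For every $\eta\in(0,1]$ there are $m\ge2$, a connected graph $\mathcal G$ on $m$ nodes and a gossip matrix $\Lambda$ for $\mathcal G$ with eigengap $\eta$ such that, for all $L_f,R,\tau_c,\varepsilon>0$ with $\varepsilon\le c_0L_fR^2$ and every dimension $d\ge\sqrt{L_fR^2/\varepsilon}$, there are convex $L_f$-smooth functions $f_1,\dots,f_m:\mathbb R^d\to\mathbb R$ and a solution $\mathbf x^\star$ of $\min_{\mathbf x\in\mathcal C} f(\mathbf x)$ with $\|\mathbf x^{(0)}-\mathbf x^\star\|=\|\mathbf x^\star\|=R$ for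 which every algorithm in $\mathcal A$ on $\mathcal G$ and every time $t\ge 0$ with $G(\mathbf x^{(t)})\le\varepsilon$ satisfy $$t\ \ge\ c\Bigl(1+\frac{\tau_c}{\sqrt\eta}\Bigr)\Bigl(\sqrt{\frac{L_fR^2}{\varepsilon}}+\frac{R\,\|\nabla f(\mathbf x^\star)\|}{\varepsilon}\Bigr) \qquad\text{and}\qquad t\ \ge\ c\Bigl(1+\frac{\tau_c}{\sqrt\eta}\Bigr)\sqrt{\frac{L_fR^2}{\varepsilon}} .$$ Moreover, for these functions, $$c\,\sqrt{\frac{L_fR^2}{\varepsilon}}\ \le\ \frac{R\,\|\nabla f(\mathbf x^\star)\|}{\varepsilon}\ \le\ C\,\sqrt{\frac{L_fR^2}{\varepsilon}},$$ so that the two lower bounds are equivalent up to absolute constants. -/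

import Mathlib

open scoped Gradient

noncomputable section

namespace DecentralizedOpt

/-- Stacks `𝐱 = [x₁, …, x_m]ᵀ ∈ ℝ^{m × d}` of `m` local vectors of `ℝ^d`. The norm is the Frobenius
norm `√(∑ ‖x_i‖²)` and `inner ℝ` is the Frobenius inner product `∑ ⟪x_i, y_i⟫`. -/
abbrev Stack (m d : ℕ) : Type := PiLp 2 (fun _ : Fin m => EuclideanSpace ℝ (Fin d))

/-- `L`-smoothness: differentiability together with an `L`-Lipschitz gradient. -/
def IsSmoothWith {d : ℕ} (L : ℝ) (g : EuclideanSpace ℝ (Fin d) → ℝ) : Prop :=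
  Differentiable ℝ g ∧ ∀ x y, ‖∇ g x - ∇ g y‖ ≤ L * ‖x - y‖

/-- The separable objective `f(𝐱) = ∑ i, f_i(x_i)`. -/
def stackObjective {m d : ℕ} (f : Fin m → EuclideanSpace ℝ (Fin d) → ℝ) (x : Stack m d) : ℝ :=
  ∑ i, f i (x i)

/-- Its gradient `∇f(𝐱) = [∇f₁(x₁), …, ∇f_m(x_m)]ᵀ`. -/
def stackGradient {m d : ℕ} (f : Fin m → EuclideanSpace ℝ (Fin d) → ℝ) (x : Stack m d) :
    Stack m d :=
  WithLp.toLp 2 (fun i => ∇ (f i) (x i))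

/-- The consensus space `𝒞 = {𝟏 xᵀ | x ∈ ℝ^d}`. -/
def consensusSpace (m d : ℕ) : Set (Stack m d) :=
  {x | ∃ v : EuclideanSpace ℝ (Fin d), ∀ i, x i = v}

/-- `𝐱⋆` solves `min f(𝐱)` subject to `𝐱 ∈ 𝒞`; equivalently `𝐱⋆ = 𝟏 xᵀ` with `x` a minimizer of
`F = ∑ i, f_i` over `ℝ^d`. -/
def IsConsensusSolution {m d : ℕ} (f : Fin m → EuclideanSpace ℝ (Fin d) → ℝ)
    (xstar : Stack m d) : Prop :=
  xstar ∈ consensusSpace m d ∧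
    ∀ z ∈ consensusSpace m d, stackObjective f xstar ≤ stackObjective f z

/-- The Bregman distance `G(𝐱, 𝐱⋆) = f(𝐱) - f(𝐱⋆) - ⟪∇f(𝐱⋆), 𝐱 - 𝐱⋆⟫`. -/
def bregman {m d : ℕ} (f : Fin m → EuclideanSpace ℝ (Fin d) → ℝ) (x xstar : Stack m d) : ℝ :=
  stackObjective f x - stackObjective f xstar - inner ℝ (stackGradient f xstar) (x - xstar)

/-- Gossip matrices of a graph: induced by the graph (off-diagonal entries vanish off the edges),
symmetric positive semidefinite, with null space spanned by the all-ones vector. -/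
structure IsGossipMatrix {m : ℕ} (𝒢 : SimpleGraph (Fin m)) (Λ : Matrix (Fin m) (Fin m) ℝ) :
    Prop where
  induced : ∀ i j, Λ i j ≠ 0 → i = j ∨ 𝒢.Adj i j
  posSemidef : Λ.PosSemidef
  null : LinearMap.ker (Matrix.toLin' Λ) = Submodule.span ℝ {fun _ => (1 : ℝ)}

/-- The eigengap `λ₂ / λ_m` of a symmetric matrix with eigenvalues `λ₁ ≤ λ₂ ≤ … ≤ λ_m`, `m ≥ 2`.
Mathlib's `eigenvalues₀` lists the eigenvalues with multiplicity in decreasing order, starting at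
index `0`, so `λ₂` has index `m - 2` and `λ_m` has index `0`. -/
def eigengap {m : ℕ} (hm : 2 ≤ m) {Λ : Matrix (Fin m) (Fin m) ℝ} (hΛ : Λ.IsHermitian) : ℝ :=
  hΛ.eigenvalues₀ ⟨m - 2, by rw [Fintype.card_fin]; omega⟩ /
    hΛ.eigenvalues₀ ⟨0, by rw [Fintype.card_fin]; omega⟩

/-- The distributed first-order oracle `𝒜` over the graph `𝒢` with communication time `τ` and unit
gradient time. `x t` is the stack of local variables at time `t ≥ 0`; values at negative times are
irrelevant. All local variables start at zero, and at each time `t ≥ 0` the variable of agent `i`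
lies in the span of its neighbours' variables at times `0 ≤ s < t - τ` plus the span of its own
variables and own local gradients at times `0 ≤ s < t - 1`. -/
structure FirstOrderOracle {m d : ℕ} (𝒢 : SimpleGraph (Fin m)) (τ : ℝ)
    (f : Fin m → EuclideanSpace ℝ (Fin d) → ℝ) (x : ℝ → Stack m d) : Prop where
  init : x 0 = 0
  step : ∀ t : ℝ, 0 ≤ t → ∀ i : Fin m,
    x t i ∈
      Submodule.span ℝ {v | ∃ j s, 𝒢.Adj i j ∧ 0 ≤ s ∧ s < t - τ ∧ v = x s j} ⊔
      Submodule.span ℝ {v | ∃ s, 0 ≤ s ∧ s < t - 1 ∧ (v = x s i ∨ v = ∇ (f i) (x s i))}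

end DecentralizedOpt

end

open DecentralizedOpt

/-!
The hard instance splits a chain of coordinates between two far-apart groups of agents.

The graph is the square of a path with `m = 3 (K + 1)` nodes, where `K + 1` has order `1 / √η`. The set
`A` is its first third, `B` its last third, and they are at distance at least `(K + 2) / 2`. Let `L`
be the Laplacian of the path. Its nonzero eigenvalues lie in an interval `[μ, M]` with `μ` of order
`m⁻²` and `1 ≤ M ≤ 4`, by a Poincaré inequality and a test vector
(`exists_pathLaplacian_spectrum`). The matrix `L + a L²` is a gossip matrix for the squared path,
and its eigengap decreases continuously from `μ / M` to `(μ / M)²` as `a` goes from `0` to `∞`;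
solving for `a` gives the eigengap `η` exactly (`exists_eigengap_tunedLaplacian`). When `η` is not
small, the triangle with an explicit matrix serves (`eigengap_triangleMatrix`).

The total objective is a multiple of `∑ j < n, (y j - y (j + 1))²` minus a multiple of `y 0`, where
`y j` is the `j`-th coordinate and `y n = 0`. The agents in `A` hold the odd links
`y j - y (j + 1)` and the linear term, those in `B` the even links, all others hold zero. Links of
the same parity involve disjoint coordinates, which gives the smoothness constant
(`norm_dirQuadraticGrad_sub_le`). In the minimizer all links have the same value `δ`
(`isConsensusSolution_chainSolution`), and its norm and the norm of the gradient there are computed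
exactly. The Bregman distance of a quadratic is the quadratic form of the difference; so if all
agents know only the first `k` coordinates, each of the `n - k` later links contributes
`(L_f / 4) δ²` at every agent holding it (`le_bregman_chainObjective`).

A new coordinate is produced by one gradient evaluation, in `A` and in `B` alternately, so each
costs one unit of time and one crossing of the graph (`FirstOrderOracle.mem_of_le`). Taking `n` of
order `√(L_f R² / ε)` and `k = n / 2` gives the bounds (`exists_hard_objective`).
-/

namespace DecentralizedOpt

section Spectral

open Matrix

/-! ### Eigenvalues of gossip matrices -/

section Eigen

variable {m : ℕ} {Λ : Matrix (Fin m) (Fin m) ℝ}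

theorem eigenvectorBasis_ne_zero (hΛ : Λ.IsHermitian) (i : Fin m) :
    (hΛ.eigenvectorBasis i : Fin m → ℝ) ≠ 0 := by
  intro h
  have := hΛ.eigenvectorBasis.orthonormal.ne_zero i
  exact this (by ext j; exact congrFun h j)

theorem sum_mul_eigenvectorBasis (hΛ : Λ.IsHermitian) (x y : Fin m → ℝ) :
    ∑ i, (hΛ.eigenvectorBasis i ⬝ᵥ x) * (hΛ.eigenvectorBasis i ⬝ᵥ y) = x ⬝ᵥ y := by
  have := hΛ.eigenvectorBasis.sum_inner_mul_inner (WithLp.toLp 2 x) (WithLp.toLp 2 y)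
  simp only [EuclideanSpace.inner_eq_star_dotProduct, star_trivial] at this
  rw [dotProduct_comm x y, ← this]
  refine Finset.sum_congr rfl fun i _ => ?_
  rw [dotProduct_comm _ y]

theorem eigenvectorBasis_dotProduct_mulVec (hΛ : Λ.IsHermitian) (i : Fin m) (x : Fin m → ℝ) :
    hΛ.eigenvectorBasis i ⬝ᵥ (Λ *ᵥ x) =
      hΛ.eigenvalues i * (hΛ.eigenvectorBasis i ⬝ᵥ x) := by
  have hT : Λᵀ = Λ := by simpa [conjTranspose_eq_transpose_of_trivial] using hΛ.eq
  rw [dotProduct_mulVec, ← mulVec_transpose, hT, hΛ.mulVec_eigenvectorBasis, smul_dotProduct,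
    smul_eq_mul]

/-- The spectral decomposition of the quadratic form of a symmetric matrix. -/
theorem dotProduct_mulVec_eq_sum (hΛ : Λ.IsHermitian) (x : Fin m → ℝ) :
    x ⬝ᵥ (Λ *ᵥ x) = ∑ i, hΛ.eigenvalues i * (hΛ.eigenvectorBasis i ⬝ᵥ x) ^ 2 := by
  rw [← sum_mul_eigenvectorBasis hΛ]
  refine Finset.sum_congr rfl fun i _ => ?_
  rw [eigenvectorBasis_dotProduct_mulVec]
  ring

theorem exists_eigenvectorBasis_dotProduct_ne_zero (hΛ : Λ.IsHermitian) {x : Fin m → ℝ}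
    (hx : x ≠ 0) : ∃ i, hΛ.eigenvectorBasis i ⬝ᵥ x ≠ 0 := by
  by_contra! h
  apply hx
  rw [← dotProduct_self_eq_zero, ← sum_mul_eigenvectorBasis hΛ]
  simp [h]

/-- Every eigenvalue of a symmetric matrix occurs in the list `eigenvalues`. -/
theorem exists_eigenvalues_eq (hΛ : Λ.IsHermitian) {ν : ℝ} {x : Fin m → ℝ} (hx : x ≠ 0)
    (h : Λ *ᵥ x = ν • x) : ∃ i, hΛ.eigenvalues i = ν := by
  obtain ⟨i, hi⟩ := exists_eigenvectorBasis_dotProduct_ne_zero hΛ hx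
  refine ⟨i, mul_right_cancel₀ hi ?_⟩
  rw [← eigenvectorBasis_dotProduct_mulVec, h, dotProduct_smul, smul_eq_mul]

/-- The eigengap is the ratio of the least and the greatest nonzero eigenvalue. The one-dimensional
null space makes `0` a simple eigenvalue, so the second entry from the end of the decreasing list of
eigenvalues is the least nonzero one. -/
theorem IsGossipMatrix.eigengap_eq {𝒢 : SimpleGraph (Fin m)} (hm : 2 ≤ m)
    (hΛ : IsGossipMatrix 𝒢 Λ) {μ M : ℝ} (hμ : 0 < μ) (hμM : μ ≤ M)
    {v w : Fin m → ℝ} (hv : v ≠ 0) (hΛv : Λ *ᵥ v = μ • v) (hw : w ≠ 0) (hΛw : Λ *ᵥ w = M • w)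
    (hall : ∀ (ν : ℝ) (x : Fin m → ℝ), x ≠ 0 → Λ *ᵥ x = ν • x → ν = 0 ∨ μ ≤ ν ∧ ν ≤ M) :
    eigengap hm hΛ.posSemidef.isHermitian = μ / M := by
  set h := hΛ.posSemidef.isHermitian
  set σ := Fintype.equivOfCardEq (α := Fin (Fintype.card (Fin m))) (β := Fin m)
    (Fintype.card_fin _) with hσ
  have hev : ∀ i, h.eigenvalues (σ i) = h.eigenvalues₀ i := fun i => by
    rw [IsHermitian.eigenvalues, hσ, Equiv.symm_apply_apply]
  have hcases : ∀ i, h.eigenvalues₀ i = 0 ∨ μ ≤ h.eigenvalues₀ i ∧ h.eigenvalues₀ i ≤ M :=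
    fun i => by
      rw [← hev]
      exact hall _ _ (eigenvectorBasis_ne_zero h (σ i)) (h.mulVec_eigenvectorBasis _)
  have hex : ∀ (ν : ℝ) (x : Fin m → ℝ), x ≠ 0 → Λ *ᵥ x = ν • x →
      ∃ i, h.eigenvalues₀ i = ν := fun ν x hx hΛx => by
    obtain ⟨i, hi⟩ := exists_eigenvalues_eq h hx hΛx
    exact ⟨σ.symm i, by rw [← hev, Equiv.apply_symm_apply, hi]⟩
  have hanti := h.eigenvalues₀_antitone
  -- two distinct positions with eigenvalue zero would give two orthogonal constant vectors
  have hconst : ∀ i, h.eigenvalues₀ i = 0 →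
      ∃ c : ℝ, ∀ j, h.eigenvectorBasis (σ i) j = c := by
    intro i hi
    have hmem : (h.eigenvectorBasis (σ i) : Fin m → ℝ) ∈ LinearMap.ker (Matrix.toLin' Λ) := by
      rw [LinearMap.mem_ker, Matrix.toLin'_apply, h.mulVec_eigenvectorBasis, hev, hi, zero_smul]
    rw [hΛ.null, Submodule.mem_span_singleton] at hmem
    obtain ⟨c, hc⟩ := hmem
    exact ⟨c, fun j => by rw [← congrFun hc j]; simp⟩
  have huniq : ∀ i j, h.eigenvalues₀ i = 0 → h.eigenvalues₀ j = 0 → i = j := by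
    intro i j hi hj
    by_contra hij
    obtain ⟨c, hc⟩ := hconst i hi
    obtain ⟨c', hc'⟩ := hconst j hj
    have hne : ∀ i (c : ℝ), (∀ j, h.eigenvectorBasis (σ i) j = c) → c ≠ 0 := by
      rintro i c hc rfl
      exact eigenvectorBasis_ne_zero h (σ i) (funext hc)
    have horth := h.eigenvectorBasis.orthonormal.2 (σ.injective.ne hij)
    simp only [EuclideanSpace.inner_eq_star_dotProduct] at horth
    simp only [dotProduct, star_trivial, hc, hc', Finset.sum_const, Finset.card_univ,
      Fintype.card_fin, nsmul_eq_mul] at horth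
    have hm0 : (m : ℝ) ≠ 0 := by positivity
    exact mul_ne_zero hm0 (mul_ne_zero (hne _ _ hc') (hne _ _ hc)) horth
  have hcard : Fintype.card (Fin m) = m := Fintype.card_fin m
  -- the greatest eigenvalue
  obtain ⟨iM, hiM⟩ := hex M w hw hΛw
  obtain ⟨iμ, hiμ⟩ := hex μ v hv hΛv
  have h0 : h.eigenvalues₀ ⟨0, by omega⟩ = M := by
    have hge : M ≤ h.eigenvalues₀ ⟨0, by omega⟩ := hiM ▸ hanti (Fin.mk_le_of_le_val (Nat.zero_le _))
    rcases hcases ⟨0, by omega⟩ with h0 | h0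
    · linarith
    · linarith [h0.2]
  -- the null vector `𝟏` accounts for an eigenvalue zero, which by antitonicity is the last one
  obtain ⟨i0, hi0⟩ := hex 0 (fun _ => 1) (fun h1 => by
      simpa using congrFun h1 (⟨0, by omega⟩ : Fin m)) (by
    have : (fun _ => (1 : ℝ)) ∈ LinearMap.ker (Matrix.toLin' Λ) := by
      rw [hΛ.null]; exact Submodule.mem_span_singleton_self _
    rw [zero_smul]
    simpa using this)
  have hnn : ∀ i, 0 ≤ h.eigenvalues₀ i := fun i => by
    rcases hcases i with h1 | h1
    · exact h1.ge
    · linarith [h1.1]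
  have hlast : h.eigenvalues₀ ⟨m - 1, by omega⟩ = 0 := by
    refine le_antisymm ?_ (hnn _)
    rw [← hi0]
    exact hanti (Fin.le_def.2 (by have := i0.2; simp only; omega))
  have hμ' : h.eigenvalues₀ ⟨m - 2, by omega⟩ = μ := by
    rcases hcases ⟨m - 2, by omega⟩ with h2 | h2
    · have := huniq _ _ h2 hlast
      simp only [Fin.mk.injEq] at this
      omega
    · refine le_antisymm ?_ h2.1
      have hne : (iμ : ℕ) ≠ m - 1 := by
        intro h3
        have : iμ = ⟨m - 1, by omega⟩ := Fin.ext h3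
        rw [this, hlast] at hiμ
        linarith
      rw [← hiμ]
      exact hanti (Fin.le_def.2 (by have := iμ.2; simp only; omega))
  rw [eigengap, h0, hμ']

end Eigen

/-! ### A path with its second neighbours -/

/-- The graph on `0, …, m - 1` in which distinct nodes at distance at most two are adjacent. -/
def squaredPath (m : ℕ) : SimpleGraph (Fin m) where
  Adj i j := i ≠ j ∧ (i : ℕ) ≤ j + 2 ∧ (j : ℕ) ≤ i + 2
  symm := ⟨fun _ _ h => ⟨h.1.symm, h.2.2, h.2.1⟩⟩
  loopless := ⟨fun _ h => h.1 rfl⟩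

theorem squaredPath_connected (n : ℕ) : (squaredPath (n + 1)).Connected := by
  have h : ∀ i : Fin (n + 1), (squaredPath (n + 1)).Reachable 0 i := by
    intro i
    induction i using Fin.induction with
    | zero => exact SimpleGraph.Reachable.refl _
    | succ i ih =>
      refine ih.trans (SimpleGraph.Adj.reachable ⟨?_, ?_, ?_⟩)
      · exact (Fin.castSucc_lt_succ).ne
      · simp; omega
      · simp
  exact SimpleGraph.Connected.mk fun i j => (h i).symm.trans (h j)

/-- The incidence matrix of the path on `n + 1` nodes: row `k` is the difference of the coordinates
`k` and `k + 1`. -/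
def pathIncidence (n : ℕ) : Matrix (Fin n) (Fin (n + 1)) ℝ :=
  Matrix.of fun k i => (if i = k.castSucc then 1 else 0) - (if i = k.succ then 1 else 0)

/-- The Laplacian of the path on `n + 1` nodes. -/
def pathLaplacian (n : ℕ) : Matrix (Fin (n + 1)) (Fin (n + 1)) ℝ :=
  (pathIncidence n)ᴴ * pathIncidence n

variable {n : ℕ}

theorem pathIncidence_mulVec (x : Fin (n + 1) → ℝ) (k : Fin n) :
    (pathIncidence n *ᵥ x) k = x k.castSucc - x k.succ := by
  simp [pathIncidence, mulVec, dotProduct, sub_mul, Finset.sum_sub_distrib]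

theorem posSemidef_pathLaplacian (n : ℕ) : (pathLaplacian n).PosSemidef :=
  posSemidef_conjTranspose_mul_self _

theorem dotProduct_pathLaplacian_mulVec (x : Fin (n + 1) → ℝ) :
    x ⬝ᵥ (pathLaplacian n *ᵥ x) = ∑ k : Fin n, (x k.castSucc - x k.succ) ^ 2 := by
  rw [pathLaplacian, ← mulVec_mulVec, conjTranspose_eq_transpose_of_trivial, mulVec_transpose,
    dotProduct_comm, ← dotProduct_mulVec]
  simp only [dotProduct, pathIncidence_mulVec, sq]

theorem eq_const_of_sum_sq_eq_zero {x : Fin (n + 1) → ℝ}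
    (h : ∑ k : Fin n, (x k.castSucc - x k.succ) ^ 2 = 0) (i : Fin (n + 1)) : x i = x 0 := by
  rw [Finset.sum_eq_zero_iff_of_nonneg fun k _ => sq_nonneg _] at h
  induction i using Fin.induction with
  | zero => rfl
  | succ i ih =>
    have := pow_eq_zero_iff (two_ne_zero) |>.1 (h i (Finset.mem_univ _))
    linarith

theorem pathLaplacian_mulVec_const (n : ℕ) : pathLaplacian n *ᵥ (fun _ => 1) = 0 := by
  have : pathIncidence n *ᵥ (fun _ => 1) = 0 := by
    ext k; rw [pathIncidence_mulVec]; simp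
  rw [pathLaplacian, ← mulVec_mulVec, this, mulVec_zero]

theorem pathIncidence_ne_zero {k : Fin n} {i : Fin (n + 1)} (h : pathIncidence n k i ≠ 0) :
    (i : ℕ) = k ∨ (i : ℕ) = k + 1 := by
  by_contra! hne
  apply h
  have h1 : i ≠ k.castSucc := fun h => hne.1 (by rw [h]; rfl)
  have h2 : i ≠ k.succ := fun h => hne.2 (by rw [h]; rfl)
  simp [pathIncidence, h1, h2]

theorem pathLaplacian_ne_zero {i j : Fin (n + 1)} (h : pathLaplacian n i j ≠ 0) :
    (i : ℕ) ≤ j + 1 ∧ (j : ℕ) ≤ i + 1 := by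
  rw [pathLaplacian, Matrix.mul_apply] at h
  obtain ⟨k, -, hk⟩ := Finset.exists_ne_zero_of_sum_ne_zero h
  rw [conjTranspose_apply, star_trivial] at hk
  have h1 := pathIncidence_ne_zero (left_ne_zero_of_mul hk)
  have h2 := pathIncidence_ne_zero (right_ne_zero_of_mul hk)
  omega

theorem sq_sub_zero_le (x : Fin (n + 1) → ℝ) (i : Fin (n + 1)) :
    (x i - x 0) ^ 2 ≤ n * ∑ k : Fin n, (x k.castSucc - x k.succ) ^ 2 := by
  have h : x 0 - x i = ∑ k : Fin n with k.castSucc < i, (x k.castSucc - x k.succ) := by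
    induction i using Fin.induction with
    | zero => simp
    | succ i ih =>
      have hins : (Finset.univ.filter fun k : Fin n => k.castSucc < i.succ) =
          insert i (Finset.univ.filter fun k : Fin n => k.castSucc < i.castSucc) := by
        ext k
        simp only [Finset.mem_filter_univ, Finset.mem_insert, Fin.castSucc_lt_castSucc_iff,
          Fin.castSucc_lt_succ_iff, le_iff_eq_or_lt]
      rw [hins, Finset.sum_insert (by simp), ← ih]
      ring
  have h1 := sq_sum_le_card_mul_sum_sq (s := ({k : Fin n | k.castSucc < i} : Finset (Fin n)))
    (f := fun k => x k.castSucc - x k.succ)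
  rw [← h] at h1
  have h2 : (({k : Fin n | k.castSucc < i} : Finset (Fin n)).card : ℝ) ≤ n := by
    have := Finset.card_le_univ ({k : Fin n | k.castSucc < i} : Finset (Fin n))
    rw [Fintype.card_fin] at this
    exact_mod_cast this
  have h3 : ∑ k : Fin n with k.castSucc < i, (x k.castSucc - x k.succ) ^ 2 ≤
      ∑ k : Fin n, (x k.castSucc - x k.succ) ^ 2 :=
    Finset.sum_le_sum_of_subset_of_nonneg (Finset.filter_subset _ _) fun _ _ _ => sq_nonneg _
  calc (x i - x 0) ^ 2 = (x 0 - x i) ^ 2 := by ring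
    _ ≤ _ := h1
    _ ≤ _ := mul_le_mul h2 h3 (Finset.sum_nonneg fun _ _ => sq_nonneg _) (Nat.cast_nonneg n)

/-- A Poincaré inequality on the path. -/
theorem sum_sq_le_of_sum_eq_zero {x : Fin (n + 1) → ℝ} (hx : ∑ i, x i = 0) :
    ∑ i, x i ^ 2 ≤ ((n : ℝ) + 1) ^ 2 * ∑ k : Fin n, (x k.castSucc - x k.succ) ^ 2 := by
  have h1 : ∑ i, (x i - x 0) ^ 2 = ∑ i, x i ^ 2 + (n + 1) * x 0 ^ 2 := by
    simp only [sub_sq, Finset.sum_add_distrib, Finset.sum_sub_distrib, ← Finset.mul_sum,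
      ← Finset.sum_mul, hx, Finset.sum_const, Finset.card_univ, Fintype.card_fin, nsmul_eq_mul]
    push_cast; ring
  have h2 := Finset.sum_le_sum fun i (_ : i ∈ Finset.univ) => sq_sub_zero_le x i
  rw [h1, Finset.sum_const, Finset.card_univ, Fintype.card_fin, nsmul_eq_mul] at h2
  push_cast at h2
  have hE : 0 ≤ ∑ k : Fin n, (x k.castSucc - x k.succ) ^ 2 :=
    Finset.sum_nonneg fun _ _ => sq_nonneg _
  have hn : (0 : ℝ) ≤ n := Nat.cast_nonneg n
  nlinarith [mul_nonneg hn (sq_nonneg (x 0)), sq_nonneg (x 0), mul_nonneg hn hE]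

theorem sum_sq_sub_le (x : Fin (n + 1) → ℝ) :
    ∑ k : Fin n, (x k.castSucc - x k.succ) ^ 2 ≤ 4 * ∑ i, x i ^ 2 := by
  have h1 := Fin.sum_univ_castSucc fun i => x i ^ 2
  have h2 := Fin.sum_univ_succ fun i => x i ^ 2
  have h3 : ∑ k : Fin n, (x k.castSucc - x k.succ) ^ 2 ≤
      ∑ k : Fin n, (2 * x k.castSucc ^ 2 + 2 * x k.succ ^ 2) :=
    Finset.sum_le_sum fun k _ => by nlinarith [sq_nonneg (x k.castSucc + x k.succ)]
  rw [Finset.sum_add_distrib, ← Finset.mul_sum, ← Finset.mul_sum] at h3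
  nlinarith [sq_nonneg (x 0), sq_nonneg (x (Fin.last n))]

/-- The matrix `L + a L²` for the Laplacian `L` of the path. Its eigenvalues are `λ + a λ²` for the
eigenvalues `λ` of `L`, so `a` tunes its eigengap between that of `L` and its square. -/
noncomputable def tunedLaplacian (n : ℕ) (a : ℝ) : Matrix (Fin (n + 1)) (Fin (n + 1)) ℝ :=
  pathLaplacian n + a • (pathLaplacian n * pathLaplacian n)

theorem tunedLaplacian_mulVec {a ν : ℝ} {x : Fin (n + 1) → ℝ}
    (h : pathLaplacian n *ᵥ x = ν • x) : tunedLaplacian n a *ᵥ x = (ν + a * ν ^ 2) • x := by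
  rw [tunedLaplacian, add_mulVec, smul_mulVec, ← mulVec_mulVec, h, mulVec_smul, h, smul_smul,
    smul_smul, ← add_smul, sq, mul_assoc]

theorem isGossipMatrix_tunedLaplacian {a : ℝ} (ha : 0 ≤ a) :
    IsGossipMatrix (squaredPath (n + 1)) (tunedLaplacian n a) where
  induced i j h := by
    by_cases hij : i = j
    · exact Or.inl hij
    refine Or.inr ⟨hij, ?_⟩
    rw [tunedLaplacian, Matrix.add_apply, Matrix.smul_apply, smul_eq_mul] at h
    by_cases h1 : pathLaplacian n i j = 0
    · rw [h1, zero_add, Matrix.mul_apply] at h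
      obtain ⟨k, -, hk⟩ := Finset.exists_ne_zero_of_sum_ne_zero (right_ne_zero_of_mul h)
      have h2 := pathLaplacian_ne_zero (left_ne_zero_of_mul hk)
      have h3 := pathLaplacian_ne_zero (right_ne_zero_of_mul hk)
      omega
    · have := pathLaplacian_ne_zero h1
      omega
  posSemidef := by
    have h := posSemidef_pathLaplacian n
    refine h.add (PosSemidef.smul ?_ ha)
    have h2 := posSemidef_conjTranspose_mul_self (pathLaplacian n)
    rwa [h.isHermitian.eq] at h2
  null := by
    ext x
    rw [LinearMap.mem_ker, Matrix.toLin'_apply, Submodule.mem_span_singleton]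
    constructor
    · intro h
      have h2 : 0 ≤ x ⬝ᵥ ((pathLaplacian n * pathLaplacian n) *ᵥ x) := by
        have h3 := (posSemidef_conjTranspose_mul_self (pathLaplacian n)).dotProduct_mulVec_nonneg x
        rwa [(posSemidef_pathLaplacian n).isHermitian.eq, star_trivial] at h3
      have h4 := congrArg (fun y => x ⬝ᵥ y) h
      simp only [tunedLaplacian, add_mulVec, smul_mulVec, dotProduct_add, dotProduct_smul,
        dotProduct_zero, smul_eq_mul, dotProduct_pathLaplacian_mulVec] at h4
      have h5 : ∑ k : Fin n, (x k.castSucc - x k.succ) ^ 2 = 0 :=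
        le_antisymm (by nlinarith) (Finset.sum_nonneg fun k _ => sq_nonneg _)
      refine ⟨x 0, funext fun i => ?_⟩
      rw [eq_const_of_sum_sq_eq_zero h5 i]
      simp
    · rintro ⟨c, rfl⟩
      rw [mulVec_smul, tunedLaplacian_mulVec (ν := 0) (by
        rw [pathLaplacian_mulVec_const, zero_smul])]
      simp

theorem sum_eq_zero_of_pathLaplacian_mulVec {ν : ℝ} (hν : ν ≠ 0) {x : Fin (n + 1) → ℝ}
    (h : pathLaplacian n *ᵥ x = ν • x) : ∑ i, x i = 0 := by
  have hT : (pathLaplacian n)ᵀ = pathLaplacian n := by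
    simpa [conjTranspose_eq_transpose_of_trivial] using
      (posSemidef_pathLaplacian n).isHermitian.eq
  have h1 : (fun _ => (1 : ℝ)) ⬝ᵥ (pathLaplacian n *ᵥ x) = 0 := by
    rw [dotProduct_mulVec, ← mulVec_transpose, hT, pathLaplacian_mulVec_const, zero_dotProduct]
  rw [h, dotProduct_smul, smul_eq_mul] at h1
  simpa [dotProduct] using (mul_eq_zero.1 h1).resolve_left hν

theorem bounds_of_pathLaplacian_mulVec {ν : ℝ} (hν : ν ≠ 0) {x : Fin (n + 1) → ℝ} (hx : x ≠ 0)
    (h : pathLaplacian n *ᵥ x = ν • x) : 1 ≤ ν * ((n : ℝ) + 1) ^ 2 ∧ ν ≤ 4 := by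
  have hE := dotProduct_pathLaplacian_mulVec x
  have hsq : x ⬝ᵥ x = ∑ i, x i ^ 2 := by simp only [dotProduct, sq]
  have hpos : 0 < x ⬝ᵥ x :=
    lt_of_le_of_ne (hsq ▸ Finset.sum_nonneg fun i _ => sq_nonneg _)
      (Ne.symm fun h0 => hx (dotProduct_self_eq_zero.1 h0))
  rw [h, dotProduct_smul, smul_eq_mul, hsq] at hE
  rw [hsq] at hpos
  have h1 := sum_sq_le_of_sum_eq_zero (sum_eq_zero_of_pathLaplacian_mulVec hν h)
  have h2 := sum_sq_sub_le x
  rw [← hE] at h1 h2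
  exact ⟨le_of_mul_le_mul_right (by linarith) hpos, le_of_mul_le_mul_right h2 hpos⟩

theorem sum_linear_eq_zero (n : ℕ) : ∑ i : Fin (n + 1), (2 * (i : ℝ) - n) = 0 := by
  rw [Fin.sum_univ_eq_sum_range (fun i : ℕ => 2 * (i : ℝ) - n), Finset.sum_sub_distrib,
    ← Finset.mul_sum]
  have : ∑ i ∈ Finset.range (n + 1), (i : ℝ) = n * (n + 1) / 2 := by
    induction n with
    | zero => simp
    | succ n ih => rw [Finset.sum_range_succ, ih]; push_cast; ring
  rw [this]
  simp
  ring

theorem sum_linear_sq (n : ℕ) :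
    ∑ i : Fin (n + 1), (2 * (i : ℝ) - n) ^ 2 = (n : ℝ) * (n + 1) * (n + 2) / 3 := by
  rw [Fin.sum_univ_eq_sum_range (fun i : ℕ => (2 * (i : ℝ) - n) ^ 2)]
  have h : ∀ c : ℝ, ∀ N : ℕ, ∑ i ∈ Finset.range (N + 1), (2 * (i : ℝ) - c) ^ 2 =
      2 * N * (N + 1) * (2 * N + 1) / 3 - 2 * c * N * (N + 1) + c ^ 2 * (N + 1) := by
    intro c N
    induction N with
    | zero => simp
    | succ N ih => rw [Finset.sum_range_succ, ih]; push_cast; ring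
  rw [h]
  ring

/-- The nonzero eigenvalues of the Laplacian of a path lie between `μ ≈ n⁻²` and `M ∈ [1, 4]`, which
are eigenvalues themselves. The upper bound for `μ` comes from the linear test vector `2 i - n`. -/
theorem exists_pathLaplacian_spectrum (hn : 1 ≤ n) :
    ∃ μ M : ℝ, 0 < μ ∧ μ ≤ M ∧ 1 ≤ M ∧ M ≤ 4 ∧ 1 ≤ μ * ((n : ℝ) + 1) ^ 2 ∧
      μ * ((n : ℝ) + 1) ^ 2 ≤ 12 ∧
      (∃ v : Fin (n + 1) → ℝ, v ≠ 0 ∧ pathLaplacian n *ᵥ v = μ • v) ∧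
      (∃ w : Fin (n + 1) → ℝ, w ≠ 0 ∧ pathLaplacian n *ᵥ w = M • w) ∧
      ∀ i, (posSemidef_pathLaplacian n).isHermitian.eigenvalues i = 0 ∨
        μ ≤ (posSemidef_pathLaplacian n).isHermitian.eigenvalues i ∧
        (posSemidef_pathLaplacian n).isHermitian.eigenvalues i ≤ M := by
  set h := (posSemidef_pathLaplacian n).isHermitian with hh
  set t : Fin (n + 1) → ℝ := fun i => 2 * (i : ℝ) - n with ht
  have hn' : (1 : ℝ) ≤ n := by exact_mod_cast hn
  have htE : ∑ i, h.eigenvalues i * (h.eigenvectorBasis i ⬝ᵥ t) ^ 2 = 4 * n := by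
    rw [← dotProduct_mulVec_eq_sum, dotProduct_pathLaplacian_mulVec]
    have : ∀ k : Fin n, (t k.castSucc - t k.succ) ^ 2 = 4 := fun k => by
      simp [ht]; ring
    simp [this, mul_comm]
  set N : Finset (Fin (n + 1)) := {i | h.eigenvalues i ≠ 0} with hN
  have hne : N.Nonempty := by
    by_contra! hemp
    have h0 : ∀ i, h.eigenvalues i = 0 := fun i => by
      by_contra h0
      have : i ∈ N := by simp [hN, h0]
      simp [hemp] at this
    simp [h0] at htE
    omega
  obtain ⟨p, hp, hpmin⟩ := N.exists_min_image h.eigenvalues hne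
  obtain ⟨q, hq, hqmax⟩ := N.exists_max_image h.eigenvalues hne
  have hp0 : h.eigenvalues p ≠ 0 := by simpa [hN] using hp
  have hq0 : h.eigenvalues q ≠ 0 := by simpa [hN] using hq
  have hpq := hpmin q hq
  have hpb := bounds_of_pathLaplacian_mulVec hp0 (eigenvectorBasis_ne_zero h p)
    (h.mulVec_eigenvectorBasis p)
  have hqb := bounds_of_pathLaplacian_mulVec hq0 (eigenvectorBasis_ne_zero h q)
    (h.mulVec_eigenvectorBasis q)
  have hpos : 0 < h.eigenvalues p :=
    lt_of_le_of_ne ((posSemidef_pathLaplacian n).eigenvalues_nonneg p) hp0.symm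
  have hall : ∀ i, h.eigenvalues i = 0 ∨
      h.eigenvalues p ≤ h.eigenvalues i ∧ h.eigenvalues i ≤ h.eigenvalues q := fun i => by
    by_cases hi : h.eigenvalues i = 0
    · exact Or.inl hi
    · exact Or.inr ⟨hpmin i (by simp [hN, hi]), hqmax i (by simp [hN, hi])⟩
  refine ⟨h.eigenvalues p, h.eigenvalues q, hpos, hpq, ?_, hqb.2, hpb.1, ?_,
    ⟨_, eigenvectorBasis_ne_zero h p, h.mulVec_eigenvectorBasis p⟩,
    ⟨_, eigenvectorBasis_ne_zero h q, h.mulVec_eigenvectorBasis q⟩, hall⟩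
  · -- the first coordinate vector has unit norm and energy at least one
    set s : Fin (n + 1) → ℝ := Pi.single 0 1 with hs
    have h1 : s ⬝ᵥ (pathLaplacian n *ᵥ s) ≤ h.eigenvalues q * (s ⬝ᵥ s) := by
      rw [dotProduct_mulVec_eq_sum h, ← sum_mul_eigenvectorBasis h, Finset.mul_sum]
      refine Finset.sum_le_sum fun i _ => ?_
      rw [← sq]
      refine mul_le_mul_of_nonneg_right ?_ (sq_nonneg _)
      rcases hall i with hi | hi
      · linarith
      · exact hi.2
    have h2 : s ⬝ᵥ s = 1 := by simp [hs]
    have h3 : 1 ≤ s ⬝ᵥ (pathLaplacian n *ᵥ s) := by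
      rw [dotProduct_pathLaplacian_mulVec]
      refine le_trans ?_ (Finset.single_le_sum (fun k _ => sq_nonneg _)
        (Finset.mem_univ (⟨0, hn⟩ : Fin n)))
      have h4 : (⟨0, hn⟩ : Fin n).castSucc = 0 := rfl
      have h5 : (⟨0, hn⟩ : Fin n).succ ≠ 0 := Fin.succ_ne_zero _
      rw [h4, hs, Pi.single_eq_same, Pi.single_eq_of_ne h5]
      norm_num
    rw [h2] at h1
    linarith
  · have h1 : h.eigenvalues p * (t ⬝ᵥ t) ≤ 4 * n := by
      rw [← htE, ← sum_mul_eigenvectorBasis h, Finset.mul_sum]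
      refine Finset.sum_le_sum fun i _ => ?_
      rw [← sq]
      rcases hall i with hi | hi
      · -- null vectors are constant, hence orthogonal to `t`
        have h2 := h.mulVec_eigenvectorBasis i
        rw [hi, zero_smul] at h2
        have h3 := dotProduct_pathLaplacian_mulVec (h.eigenvectorBasis i)
        rw [h2, dotProduct_zero] at h3
        have h4 : h.eigenvectorBasis i ⬝ᵥ t = 0 := by
          simp only [dotProduct, eq_const_of_sum_sq_eq_zero h3.symm, ← Finset.mul_sum]
          rw [ht, sum_linear_eq_zero, mul_zero]
        rw [h4]; simp
      · exact mul_le_mul_of_nonneg_right hi.1 (sq_nonneg _)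
    have h2 : t ⬝ᵥ t = n * (n + 1) * (n + 2) / 3 := by
      rw [← sum_linear_sq]
      simp only [dotProduct, ht, sq]
    rw [h2] at h1
    have h3 : (n : ℝ) * (h.eigenvalues p * (n + 1) * (n + 2)) ≤ n * 12 := by linarith
    have h4 := le_of_mul_le_mul_left h3 (by linarith)
    nlinarith [mul_pos hpos (by linarith : (0 : ℝ) < n + 1)]

/-- For `r² < η ≤ r`, where `r = μ / M` is the eigengap of the path, some `a ≥ 0` gives
`L + a L²` the eigengap `η`. -/
theorem exists_eigengap_tunedLaplacian (hn : 1 ≤ n) {η : ℝ} (hη : 0 < η)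
    (h1 : η * (4 * ((n : ℝ) + 1) ^ 2) ≤ 1) (h2 : 144 < η * ((n : ℝ) + 1) ^ 4) :
    ∃ (Λ : Matrix (Fin (n + 1)) (Fin (n + 1)) ℝ) (hΛ : IsGossipMatrix (squaredPath (n + 1)) Λ),
      eigengap (by omega) hΛ.posSemidef.isHermitian = η := by
  obtain ⟨μ, M, hμ, hμM, hM1, hM4, hμl, hμu, ⟨v, hv, hLv⟩, ⟨w, hw, hLw⟩, hall⟩ :=
    exists_pathLaplacian_spectrum hn
  have hm : (0 : ℝ) < (n + 1) ^ 2 := by positivity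
  have hnum : η * M ≤ μ := by
    refine le_of_mul_le_mul_right ?_ hm
    nlinarith [mul_le_mul_of_nonneg_left hM4 (mul_pos hη hm).le]
  have hden : μ ^ 2 < η * M ^ 2 := by
    have h3 : μ ^ 2 * ((n : ℝ) + 1) ^ 4 ≤ 144 := by
      have : (μ * ((n : ℝ) + 1) ^ 2) ^ 2 ≤ 12 ^ 2 := pow_le_pow_left₀ (by positivity) hμu 2
      linarith [this, (by ring : (μ * ((n : ℝ) + 1) ^ 2) ^ 2 = μ ^ 2 * ((n : ℝ) + 1) ^ 4)]
    have h4 : μ ^ 2 < η :=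
      lt_of_mul_lt_mul_right (h3.trans_lt h2) (by positivity)
    nlinarith [mul_le_mul_of_nonneg_left (one_le_pow₀ hM1 : 1 ≤ M ^ 2) hη.le]
  set a := (μ - η * M) / (η * M ^ 2 - μ ^ 2) with ha
  have hden' : 0 < η * M ^ 2 - μ ^ 2 := by linarith
  have ha0 : 0 ≤ a := div_nonneg (by linarith) hden'.le
  have hmono : ∀ {b c : ℝ}, 0 ≤ b → b ≤ c → b + a * b ^ 2 ≤ c + a * c ^ 2 := fun hb hbc => by
    have := mul_le_mul_of_nonneg_left (pow_le_pow_left₀ hb hbc 2) ha0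
    linarith
  have hΛ := isGossipMatrix_tunedLaplacian (n := n) ha0
  refine ⟨tunedLaplacian n a, hΛ, ?_⟩
  have hMpos : 0 < M := by linarith
  rw [hΛ.eigengap_eq (by omega) (μ := μ + a * μ ^ 2) (M := M + a * M ^ 2) (by positivity)
    (hmono hμ.le hμM) hv (tunedLaplacian_mulVec hLv) hw (tunedLaplacian_mulVec hLw)]
  · rw [div_eq_iff (by positivity)]
    have : a * (η * M ^ 2 - μ ^ 2) = μ - η * M := div_mul_cancel₀ _ hden'.ne'
    linear_combination -this
  · intro ν x hx hνx
    -- expand `x` in an eigenbasis of the path Laplacian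
    set h := (posSemidef_pathLaplacian n).isHermitian
    obtain ⟨i, hi⟩ := exists_eigenvectorBasis_dotProduct_ne_zero h hx
    have hν : ν = h.eigenvalues i + a * h.eigenvalues i ^ 2 := by
      refine mul_right_cancel₀ hi ?_
      have h3 := congrArg (fun y => h.eigenvectorBasis i ⬝ᵥ y) hνx
      simp only [tunedLaplacian, add_mulVec, smul_mulVec, ← mulVec_mulVec, dotProduct_add,
        dotProduct_smul, smul_eq_mul, eigenvectorBasis_dotProduct_mulVec] at h3
      linarith
    rcases hall i with h0 | h0
    · left; rw [hν, h0]; ring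
    · right
      rw [hν]
      exact ⟨hmono hμ.le h0.1, hmono (hμ.le.trans h0.1) h0.2⟩

/-! ### Three nodes -/

/-- The matrix on three nodes with eigenvalues `0`, `η`, `1` for the eigenvectors `(1, 1, 1)`,
`(1, 1, -2)`, `(1, -1, 0)`. -/
noncomputable def triangleMatrix (η : ℝ) : Matrix (Fin 3) (Fin 3) ℝ :=
  !![1 / 2 + η / 6, -1 / 2 + η / 6, -η / 3;
     -1 / 2 + η / 6, 1 / 2 + η / 6, -η / 3;
     -η / 3, -η / 3, 2 * η / 3]

theorem triangleMatrix_mulVec (η : ℝ) (x : Fin 3 → ℝ) :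
    triangleMatrix η *ᵥ x =
      ![(x 0 - x 1) / 2 + η * (x 0 + x 1 - 2 * x 2) / 6,
        -(x 0 - x 1) / 2 + η * (x 0 + x 1 - 2 * x 2) / 6,
        -η * (x 0 + x 1 - 2 * x 2) / 3] := by
  ext i
  fin_cases i <;> simp [triangleMatrix, mulVec, dotProduct, Fin.sum_univ_three] <;> ring

theorem isGossipMatrix_triangleMatrix {η : ℝ} (hη : 0 < η) :
    IsGossipMatrix (squaredPath 3) (triangleMatrix η) where
  induced i j _ := by
    by_cases hij : i = j
    · exact Or.inl hij
    · exact Or.inr ⟨hij, by omega, by omega⟩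
  posSemidef := by
    refine PosSemidef.of_dotProduct_mulVec_nonneg ?_ fun x => ?_
    · ext i j
      fin_cases i <;> fin_cases j <;> simp [triangleMatrix]
    · rw [triangleMatrix_mulVec, star_trivial]
      simp only [dotProduct, Fin.sum_univ_three, cons_val_zero, cons_val_one, cons_val]
      nlinarith [sq_nonneg (x 0 - x 1), mul_nonneg hη.le (sq_nonneg (x 0 + x 1 - 2 * x 2))]
  null := by
    ext x
    rw [LinearMap.mem_ker, Matrix.toLin'_apply, Submodule.mem_span_singleton,
      triangleMatrix_mulVec]
    constructor
    · intro h
      have h0 := congrFun h 0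
      have h1 := congrFun h 1
      have h2 := congrFun h 2
      simp only [cons_val_zero, cons_val_one, cons_val, Pi.zero_apply] at h0 h1 h2
      have h3 : x 0 + x 1 - 2 * x 2 = 0 := by
        have : η * (x 0 + x 1 - 2 * x 2) = 0 := by linarith
        exact (mul_eq_zero.1 this).resolve_left hη.ne'
      refine ⟨x 0, ?_⟩
      ext i
      fin_cases i <;> simp <;> linarith
    · rintro ⟨c, rfl⟩
      ext i
      fin_cases i <;> norm_num <;> right <;> ring

theorem eigengap_triangleMatrix {η : ℝ} (hη : 0 < η) (hη1 : η ≤ 1) :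
    eigengap (by norm_num) (isGossipMatrix_triangleMatrix hη).posSemidef.isHermitian = η := by
  rw [(isGossipMatrix_triangleMatrix hη).eigengap_eq (by norm_num) (μ := η) (M := 1) hη hη1
    (v := ![1, 1, -2]) (w := ![1, -1, 0]), div_one]
  · exact fun h => by simpa using congrFun h 0
  · rw [triangleMatrix_mulVec]
    ext i
    fin_cases i <;> simp <;> ring
  · exact fun h => by simpa using congrFun h 0
  · rw [triangleMatrix_mulVec]
    ext i
    fin_cases i <;> norm_num <;> exact Or.inr rfl
  · intro ν x hx h
    rw [triangleMatrix_mulVec] at h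
    have h0 := congrFun h 0
    have h1 := congrFun h 1
    have h2 := congrFun h 2
    simp only [cons_val_zero, cons_val_one, cons_val, Pi.smul_apply, smul_eq_mul] at h0 h1 h2
    by_contra! hν
    have hs : ν * (x 0 + x 1 + x 2) = 0 := by linarith
    have hu : (1 - ν) * (x 0 - x 1) = 0 := by linarith
    have hv : (η - ν) * (x 0 + x 1 - 2 * x 2) = 0 := by linarith
    have hν1 : 1 - ν ≠ 0 := fun h' => by linarith [hν.2 (by linarith)]
    have hνη : η - ν ≠ 0 := fun h' => by linarith [hν.2 (by linarith)]
    have hs := (mul_eq_zero.1 hs).resolve_left hν.1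
    have hu := (mul_eq_zero.1 hu).resolve_left hν1
    have hv := (mul_eq_zero.1 hv).resolve_left hνη
    apply hx
    ext i
    fin_cases i <;> simp <;> linarith

/-! ### Prescribed eigengaps -/

/-- Every eigengap `η ∈ (0, 1]` occurs on the squared path with `3 (K + 1)` nodes where `K + 1`
is at least a constant times `1 / √η`. -/
theorem exists_gossipMatrix_eigengap_eq {η : ℝ} (hη : 0 < η) (hη1 : η ≤ 1) :
    ∃ (K : ℕ) (Λ : Matrix (Fin (3 * K + 2 + 1)) (Fin (3 * K + 2 + 1)) ℝ)
      (hΛ : IsGossipMatrix (squaredPath (3 * K + 2 + 1)) Λ),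
      eigengap (by omega) hΛ.posSemidef.isHermitian = η ∧ 1 ≤ √η * (200 * ((K : ℝ) + 1)) := by
  have hs : 0 < √η := Real.sqrt_pos.2 hη
  have hs2 : √η * √η = η := Real.mul_self_sqrt hη.le
  rcases le_or_gt (1 / 40000) η with h | h
  · refine ⟨0, triangleMatrix η, isGossipMatrix_triangleMatrix hη,
      eigengap_triangleMatrix hη hη1, ?_⟩
    have : 1 / 200 ≤ √η := Real.le_sqrt_of_sq_le (by norm_num; linarith)
    push_cast; linarith
  · have hs1 : √η < 1 / 200 := by
      rw [Real.sqrt_lt' (by norm_num)]; norm_num; linarith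
    -- the number of nodes `m = 3 (K + 1)` satisfies `1 / 4 ≤ m √η ≤ 1 / 2`
    obtain ⟨K, hK⟩ : ∃ K, ⌊1 / (6 * √η)⌋₊ = K + 1 :=
      Nat.exists_eq_succ_of_ne_zero (Nat.floor_pos.2 (by
        rw [le_div_iff₀ (by positivity)]; linarith)).ne'
    have hle := Nat.floor_le (by positivity : 0 ≤ 1 / (6 * √η))
    have hlt := Nat.lt_floor_add_one (1 / (6 * √η))
    rw [hK] at hle hlt
    push_cast at hle hlt
    rw [le_div_iff₀ (by positivity)] at hle
    rw [div_lt_iff₀ (by positivity)] at hlt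
    set u := 3 * ((K : ℝ) + 1) * √η with hu
    have hu1 : u ≤ 1 / 2 := by rw [hu]; linarith
    have hu2 : 1 / 4 ≤ u := by rw [hu]; linarith
    have hcast : (((3 * K + 2 : ℕ) : ℝ) + 1) = 3 * (K + 1) := by push_cast; ring
    have hun : η * (3 * ((K : ℝ) + 1)) ^ 2 = u ^ 2 := by
      rw [hu]; linear_combination -(3 * ((K : ℝ) + 1)) ^ 2 * hs2
    obtain ⟨Λ, hΛ, hgap⟩ := exists_eigengap_tunedLaplacian (n := 3 * K + 2) (by omega) hη
      (by rw [hcast]; nlinarith) (by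
        rw [hcast]
        have h1 : (1 / 4 : ℝ) ^ 4 ≤ u ^ 4 := pow_le_pow_left₀ (by norm_num) hu2 4
        have h2 : η * (η * (3 * ((K : ℝ) + 1)) ^ 4) = u ^ 4 := by
          linear_combination (η * (3 * ((K : ℝ) + 1)) ^ 2 + u ^ 2) * hun
        refine lt_of_mul_lt_mul_left (a := η) ?_ hη.le
        rw [h2]
        norm_num at h1
        linarith)
    refine ⟨K, Λ, hΛ, hgap, ?_⟩
    rw [hu] at hu2
    nlinarith

end Spectral

/-! ### Quadratics along orthogonal directions -/

section Quadratic

variable {E : Type*} [NormedAddCommGroup E] [InnerProductSpace ℝ E]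

/-- The quadratic `x ↦ L / 4 * ∑ j ∈ P, ⟪a j, x⟫² - ⟪g, x⟫` with directions `a j` and linear
part `g`. -/
noncomputable def dirQuadratic (L : ℝ) (a : ℕ → E) (P : Finset ℕ) (g x : E) : ℝ :=
  L / 4 * ∑ j ∈ P, inner ℝ (a j) x ^ 2 - inner ℝ g x

/-- The gradient of `dirQuadratic L a P g` at `x`. -/
noncomputable def dirQuadraticGrad (L : ℝ) (a : ℕ → E) (P : Finset ℕ) (g x : E) : E :=
  (L / 2) • ∑ j ∈ P, inner ℝ (a j) x • a j - g

variable (L : ℝ) (a : ℕ → E) (P : Finset ℕ) (g : E)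

theorem hasGradientAt_dirQuadratic [CompleteSpace E] (x : E) :
    HasGradientAt (dirQuadratic L a P g) (dirQuadraticGrad L a P g x) x := by
  rw [hasGradientAt_iff_hasFDerivAt]
  have h : HasFDerivAt (dirQuadratic L a P g) _ x :=
    ((HasFDerivAt.fun_sum (u := P) fun j _ =>
      ((innerSL ℝ (a j)).hasFDerivAt (x := x)).pow 2).const_mul (L / 4)).sub
      ((innerSL ℝ g).hasFDerivAt (x := x))
  refine h.congr_fderiv ?_
  ext y
  simp only [dirQuadraticGrad, map_sub, map_smul, map_sum, sub_apply,
    smul_apply, sum_apply, innerSL_apply_apply,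
    InnerProductSpace.toDual_apply_apply, smul_eq_mul, Finset.mul_sum]
  congr 1
  refine Finset.sum_congr rfl fun j _ => ?_
  simp
  ring

theorem gradient_dirQuadratic [CompleteSpace E] (x : E) :
    ∇ (dirQuadratic L a P g) x = dirQuadraticGrad L a P g x :=
  (hasGradientAt_dirQuadratic L a P g x).gradient

theorem convexOn_dirQuadratic (hL : 0 ≤ L) :
    ConvexOn ℝ Set.univ (dirQuadratic L a P g) := by
  refine ⟨convex_univ, fun x _ y _ s t hs ht hst => ?_⟩
  have key : ∀ j ∈ P, inner ℝ (a j) (s • x + t • y) ^ 2 ≤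
      s * inner ℝ (a j) x ^ 2 + t * inner ℝ (a j) y ^ 2 := by
    intro j _
    rw [inner_add_right, inner_smul_right, inner_smul_right]
    obtain rfl : t = 1 - s := by linarith
    nlinarith [mul_nonneg (mul_nonneg hs ht)
      (sq_nonneg (inner ℝ (a j) x - inner ℝ (a j) y))]
  have hsum := mul_le_mul_of_nonneg_left (Finset.sum_le_sum key) (by positivity : 0 ≤ L / 4)
  rw [Finset.sum_add_distrib, ← Finset.mul_sum, ← Finset.mul_sum] at hsum
  simp only [dirQuadratic, smul_eq_mul, inner_add_right, inner_smul_right] at hsum ⊢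
  linarith

theorem dirQuadratic_bregman (x z : E) :
    dirQuadratic L a P g x - dirQuadratic L a P g z - inner ℝ (dirQuadraticGrad L a P g z) (x - z)
      = L / 4 * ∑ j ∈ P, inner ℝ (a j) (x - z) ^ 2 := by
  simp only [dirQuadratic, dirQuadraticGrad, inner_sub_left, inner_smul_left, sum_inner,
    inner_sub_right, Finset.mul_sum]
  rw [← sub_eq_zero]
  simp only [RCLike.conj_to_real]
  have : ∑ j ∈ P, L / 4 * inner ℝ (a j) x ^ 2 - ∑ j ∈ P, L / 4 * inner ℝ (a j) z ^ 2
      - (∑ j ∈ P, L / 2 * (inner ℝ (a j) z * inner ℝ (a j) x)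
        - ∑ j ∈ P, L / 2 * (inner ℝ (a j) z * inner ℝ (a j) z))
      - ∑ j ∈ P, L / 4 * (inner ℝ (a j) x - inner ℝ (a j) z) ^ 2 = 0 := by
    rw [← Finset.sum_sub_distrib, ← Finset.sum_sub_distrib, ← Finset.sum_sub_distrib,
      ← Finset.sum_sub_distrib]
    exact Finset.sum_eq_zero fun j _ => by ring
  linarith

variable {a P} in
/-- For orthogonal directions of squared norm at most `2` the Hessian is bounded by `L`: with
`S z = ∑ ⟪a j, z⟫ a j` one has `‖S z‖² ≤ 2 ⟪S z, z⟫ ≤ 2 ‖S z‖ ‖z‖`. -/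
theorem norm_dirQuadraticGrad_sub_le (hL : 0 ≤ L)
    (horth : ∀ i ∈ P, ∀ j ∈ P, i ≠ j → inner ℝ (a i) (a j) = 0)
    (hnorm : ∀ j ∈ P, inner ℝ (a j) (a j) ≤ 2) (x y : E) :
    ‖dirQuadraticGrad L a P g x - dirQuadraticGrad L a P g y‖ ≤ L * ‖x - y‖ := by
  set z := x - y
  set S := ∑ j ∈ P, inner ℝ (a j) z • a j with hS
  have hdiff : dirQuadraticGrad L a P g x - dirQuadraticGrad L a P g y = (L / 2) • S := by
    simp only [dirQuadraticGrad, hS, z, inner_sub_right, sub_smul, Finset.sum_sub_distrib, smul_sub]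
    abel
  have h1 : inner ℝ S z = ∑ j ∈ P, inner ℝ (a j) z ^ 2 := by
    simp only [hS, sum_inner, inner_smul_left, RCLike.conj_to_real, sq]
  have h2 : inner ℝ S S ≤ 2 * inner ℝ S z := by
    rw [h1, Finset.mul_sum]
    conv_lhs => rw [hS]
    rw [sum_inner]
    refine Finset.sum_le_sum fun i hi => ?_
    have : inner ℝ (a i) S = inner ℝ (a i) z * inner ℝ (a i) (a i) := by
      rw [hS, inner_sum, Finset.sum_eq_single_of_mem i hi, inner_smul_right]
      intro j hj hji
      rw [inner_smul_right, horth i hi j hj (Ne.symm hji), mul_zero]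
    rw [inner_smul_left, this, RCLike.conj_to_real]
    nlinarith [mul_le_mul_of_nonneg_left (hnorm i hi) (sq_nonneg (inner ℝ (a i) z))]
  have h3 : ‖S‖ ≤ 2 * ‖z‖ := by
    rw [real_inner_self_eq_norm_sq] at h2
    have h4 := real_inner_le_norm S z
    rcases (norm_nonneg S).eq_or_lt with h0 | h0
    · rw [← h0]; positivity
    · nlinarith
  rw [hdiff, norm_smul, Real.norm_of_nonneg (by positivity)]
  nlinarith

end Quadratic

/-! ### The chain of coordinates -/

section Chain

variable {E : Type*} [NormedAddCommGroup E] [InnerProductSpace ℝ E]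

/-- `e 0, …, e (n - 1)` are orthonormal and `e j = 0` for `j ≥ n`. -/
def IsChainBasis (n : ℕ) (e : ℕ → E) : Prop :=
  ∀ i j, inner ℝ (e i) (e j) = if i = j ∧ i < n then (1 : ℝ) else 0

theorem exists_isChainBasis {n d : ℕ} (h : n ≤ d) :
    ∃ e : ℕ → EuclideanSpace ℝ (Fin d), IsChainBasis n e := by
  refine ⟨fun j => if hj : j < n then EuclideanSpace.single ⟨j, hj.trans_le h⟩ 1 else 0, ?_⟩
  intro i j
  by_cases hi : i < n <;> by_cases hj : j < n
  · simp [hi, hj, EuclideanSpace.inner_single_left, Fin.ext_iff]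
  · have : i ≠ j := by rintro rfl; exact hj hi
    simp [hj, this]
  · simp [hi]
  · simp [hi]

/-- The difference `e j - e (j + 1)` of consecutive chain directions; for `j = n - 1` it is the
last direction itself. -/
def link (e : ℕ → E) (j : ℕ) : E := e j - e (j + 1)

/-- The points all of whose chain coordinates from the `k`-th on vanish. -/
def chainHead (e : ℕ → E) (k : ℕ) : Submodule ℝ E where
  carrier := {x | ∀ j, k ≤ j → inner ℝ (e j) x = 0}
  zero_mem' := fun j _ => inner_zero_right _
  add_mem' := fun {x y} hx hy j hj => by rw [inner_add_right, hx j hj, hy j hj, add_zero]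
  smul_mem' := fun c x hx j hj => by rw [inner_smul_right, hx j hj, mul_zero]

theorem mem_chainHead {e : ℕ → E} {k : ℕ} {x : E} :
    x ∈ chainHead e k ↔ ∀ j, k ≤ j → inner ℝ (e j) x = 0 := Iff.rfl

/-- The consensus solution restricted to one agent: its chain coordinates decrease linearly, with
all differences equal to `δ`. -/
noncomputable def chainPoint (e : ℕ → E) (n : ℕ) (δ : ℝ) : E :=
  ∑ j ∈ Finset.range n, (δ * ((n : ℝ) - j)) • e j


variable {n : ℕ} {e : ℕ → E}

namespace IsChainBasis

theorem inner_of_ne (he : IsChainBasis n e) {i j : ℕ} (h : i ≠ j) : inner ℝ (e i) (e j) = 0 := by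
  rw [he, if_neg fun h' => h h'.1]

theorem eq_zero (he : IsChainBasis n e) {i : ℕ} (h : n ≤ i) : e i = 0 := by
  rw [← inner_self_eq_zero (𝕜 := ℝ), he, if_neg fun h' => absurd h'.2 (by omega)]

theorem inner_link_self_le (he : IsChainBasis n e) (j : ℕ) :
    inner ℝ (link e j) (link e j) ≤ 2 := by
  have h : ∀ i, inner ℝ (e i) (e i) ≤ 1 := fun i => by rw [he]; split_ifs <;> norm_num
  rw [link, inner_sub_left, inner_sub_right, inner_sub_right, he.inner_of_ne (by omega : j ≠ j + 1),
    he.inner_of_ne (by omega : j + 1 ≠ j)]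
  linarith [h j, h (j + 1)]

/-- Links of the same parity are disjoint, hence orthogonal. -/
theorem inner_link_of_ne (he : IsChainBasis n e) {i j : ℕ} (h : i ≠ j) (h1 : i + 1 ≠ j)
    (h2 : j + 1 ≠ i) : inner ℝ (link e i) (link e j) = 0 := by
  rw [link, link, inner_sub_left, inner_sub_right, inner_sub_right, he.inner_of_ne h,
    he.inner_of_ne h2.symm, he.inner_of_ne h1, he.inner_of_ne (by omega : i + 1 ≠ j + 1)]
  ring

theorem inner_link_right_eq_zero (he : IsChainBasis n e) {l j : ℕ} (h : l ≠ j) (h1 : l ≠ j + 1) :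
    inner ℝ (e l) (link e j) = 0 := by
  rw [link, inner_sub_right, he.inner_of_ne h, he.inner_of_ne h1, sub_zero]

theorem inner_sum_smul (he : IsChainBasis n e) (b : ℕ → ℝ) (i : ℕ) :
    inner ℝ (e i) (∑ j ∈ Finset.range n, b j • e j) = if i < n then b i else 0 := by
  rw [inner_sum]
  simp only [inner_smul_right, he i]
  split_ifs with h
  · rw [Finset.sum_eq_single_of_mem i (Finset.mem_range.2 h)]
    · simp [h]
    · intro j _ hj
      rw [if_neg fun h' => hj h'.1.symm, mul_zero]
  · exact Finset.sum_eq_zero fun j _ => by simp [h]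

theorem norm_sq_sum_smul (he : IsChainBasis n e) (b : ℕ → ℝ) :
    ‖∑ j ∈ Finset.range n, b j • e j‖ ^ 2 = ∑ j ∈ Finset.range n, b j ^ 2 := by
  rw [← real_inner_self_eq_norm_sq, sum_inner]
  refine Finset.sum_congr rfl fun j hj => ?_
  rw [inner_smul_left, he.inner_sum_smul, if_pos (Finset.mem_range.1 hj), RCLike.conj_to_real, sq]

theorem inner_link_chainPoint (he : IsChainBasis n e) (δ : ℝ) {j : ℕ} (hj : j < n) :
    inner ℝ (link e j) (chainPoint e n δ) = δ := by
  rw [link, inner_sub_left, chainPoint, he.inner_sum_smul, he.inner_sum_smul, if_pos hj]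
  split_ifs with h
  · push_cast; ring
  · obtain rfl : n = j + 1 := by omega
    push_cast; ring

theorem norm_sq_chainPoint (he : IsChainBasis n e) (δ : ℝ) :
    ‖chainPoint e n δ‖ ^ 2 = δ ^ 2 * (n * (n + 1) * (2 * n + 1) / 6) := by
  rw [chainPoint, he.norm_sq_sum_smul]
  simp only [mul_pow, ← Finset.mul_sum]
  congr 1
  rw [← Finset.sum_range_reflect]
  have : ∀ j ∈ Finset.range n, ((n : ℝ) - ((n - 1 - j : ℕ) : ℝ)) ^ 2 = ((j : ℝ) + 1) ^ 2 := by
    intro j hj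
    have hj := Finset.mem_range.1 hj
    have : n - 1 - j = n - (j + 1) := by omega
    rw [this, Nat.cast_sub hj]
    push_cast; ring
  rw [Finset.sum_congr rfl this]
  clear this he
  induction n with
  | zero => simp
  | succ n ih => rw [Finset.sum_range_succ, ih]; push_cast; ring

/-- The even links add up to the alternating sum of the chain directions. -/
theorem sum_link_even (he : IsChainBasis n e) :
    ∑ j ∈ Finset.range n with Even j, link e j = ∑ j ∈ Finset.range n, (-1 : ℝ) ^ j • e j := by
  have key : ∀ N : ℕ, ∑ j ∈ Finset.range N with Even j, link e j =
      ∑ j ∈ Finset.range N, (-1 : ℝ) ^ j • e j - if Even N then 0 else e N := by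
    intro N
    induction N with
    | zero => simp
    | succ N ih =>
      rw [Finset.sum_filter] at ih ⊢
      rw [Finset.sum_range_succ, Finset.sum_range_succ, ih]
      rcases Nat.even_or_odd N with hN | hN
      · have h1 : ¬ Even (N + 1) := by simpa [Nat.even_add_one] using hN
        rw [if_pos hN, if_pos hN, if_neg h1, hN.neg_one_pow, link]
        simp [add_sub_assoc]
      · have h1 : Even (N + 1) := hN.add_one
        have h2 : ¬ Even N := Nat.not_even_iff_odd.2 hN
        rw [if_neg h2, if_neg h2, if_pos h1, hN.neg_one_pow]
        simp [sub_eq_add_neg]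
  rw [key]
  split_ifs
  · rw [sub_zero]
  · rw [he.eq_zero le_rfl, sub_zero]

theorem sum_link_odd (he : IsChainBasis n e) :
    ∑ j ∈ Finset.range n with Odd j, link e j = e 0 - ∑ j ∈ Finset.range n, (-1 : ℝ) ^ j • e j := by
  rw [← he.sum_link_even, eq_sub_iff_add_eq, add_comm]
  have h := Finset.sum_filter_add_sum_filter_not (Finset.range n) (fun j => Even j) (link e)
  simp only [Nat.not_even_iff_odd] at h
  rw [h]
  simp only [link]
  rw [Finset.sum_range_sub', he.eq_zero le_rfl, sub_zero]

end IsChainBasis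

/-- One gradient of a chain quadratic keeps the leading `k` coordinates leading, unless the agent
holds the link with `j + 1 = k`, or `k = 0` and it holds the linear term. -/
theorem dirQuadraticGrad_mem_chainHead (he : IsChainBasis n e) {L c : ℝ} {P : Finset ℕ} {k : ℕ}
    {x : E} (hx : x ∈ chainHead e k) (hP : ∀ j ∈ P, j + 1 ≠ k) (hc : k = 0 → c = 0) :
    dirQuadraticGrad L (link e) P (c • e 0) x ∈ chainHead e k := by
  intro l hl
  rw [dirQuadraticGrad, inner_sub_right, inner_smul_right, inner_sum, Finset.sum_eq_zero,
    inner_smul_right]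
  · rcases Nat.eq_zero_or_pos l with rfl | h
    · rw [hc (by omega)]; simp
    · rw [he.inner_of_ne h.ne']; simp
  · intro j hj
    rw [inner_smul_right]
    rcases lt_or_ge j k with h | h
    · rw [he.inner_link_right_eq_zero (by omega) (by have := hP j hj; omega), mul_zero]
    · rw [link, inner_sub_left, hx j h, hx (j + 1) (by omega)]; simp

/-- One gradient of a chain quadratic reaches at most one more coordinate. -/
theorem dirQuadraticGrad_mem_chainHead_succ (he : IsChainBasis n e) {L c : ℝ} {P : Finset ℕ} {k : ℕ}
    {x : E} (hx : x ∈ chainHead e k) :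
    dirQuadraticGrad L (link e) P (c • e 0) x ∈ chainHead e (k + 1) := by
  intro l hl
  rw [dirQuadraticGrad, inner_sub_right, inner_smul_right, inner_sum, Finset.sum_eq_zero,
    inner_smul_right, he.inner_of_ne (by omega : l ≠ 0)]
  · simp
  · intro j hj
    rw [inner_smul_right]
    rcases lt_or_ge j k with h | h
    · rw [he.inner_link_right_eq_zero (by omega) (by omega), mul_zero]
    · rw [link, inner_sub_left, hx j h, hx (j + 1) (by omega)]; simp

end Chain

/-! ### Speed of information -/

/-- New chain coordinates are produced alternately at agents with `φ = 0` (odd ones, counted from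
one) and at agents with `φ = Δ` (even ones), where `φ` changes by at most one along an edge. Each
production costs a unit of gradient time after the previous coordinate has crossed from one end to
the other, which takes communication time `Δ τ`. -/
theorem FirstOrderOracle.mem_of_le {m d : ℕ} {𝒢 : SimpleGraph (Fin m)} {τ : ℝ}
    {f : Fin m → EuclideanSpace ℝ (Fin d) → ℝ} {x : ℝ → Stack m d}
    (hx : FirstOrderOracle 𝒢 τ f x) (hτ : 0 < τ) {φ : Fin m → ℝ} {Δ : ℝ}
    (hφ : ∀ i j, 𝒢.Adj i j → |φ i - φ j| ≤ 1)
    {S : ℕ → Submodule ℝ (EuclideanSpace ℝ (Fin d))}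
    (hsucc : ∀ i k, ∀ v ∈ S k, ∇ (f i) v ∈ S (k + 1))
    (hstay : ∀ i k, ∀ v ∈ S k, (Even k → φ i ≠ 0) → (Odd k → φ i ≠ Δ) → ∇ (f i) v ∈ S k)
    {t : ℝ} (ht : 0 ≤ t) (i : Fin m) (k : ℕ)
    (htk : t ≤ (k + 1) + k * (Δ * τ) + (if Even k then φ i else Δ - φ i) * τ) :
    x t i ∈ S k := by
  -- every dependence goes back in time by at least `min 1 τ`
  have hmin : 0 < min 1 τ := lt_min one_pos hτ
  obtain ⟨N, hN⟩ := exists_nat_gt (t / min 1 τ)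
  rw [div_lt_iff₀ hmin] at hN
  induction N generalizing t i k with
  | zero => simp at hN; linarith
  | succ N ih =>
    push_cast at hN
    have hmin1 := min_le_left 1 τ
    have hmin2 := min_le_right 1 τ
    refine (sup_le (Submodule.span_le.2 ?_) (Submodule.span_le.2 ?_) :
      _ ≤ S k) (hx.step t ht i)
    · rintro v ⟨j, s, hij, hs, hst, rfl⟩
      refine ih hs j k ?_ (by linarith)
      have h1 := abs_le.1 (hφ i j hij)
      have h2 : (if Even k then φ i else Δ - φ i) ≤ (if Even k then φ j else Δ - φ j) + 1 := by
        split_ifs <;> linarith [h1.1, h1.2]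
      nlinarith [mul_le_mul_of_nonneg_right h2 hτ.le]
    · rintro v ⟨s, hs, hst, rfl | rfl⟩
      · exact ih hs i k (by linarith) (by linarith)
      · have hk : x s i ∈ S k := ih hs i k (by linarith) (by linarith)
        by_cases hprod : (Even k → φ i ≠ 0) ∧ (Odd k → φ i ≠ Δ)
        · exact hstay i k _ hk hprod.1 hprod.2
        · -- agent `i` produces the next coordinate, so it sits at the end opposite to the
          -- one where the previous coordinate was produced
          have hend : (if Even k then φ i else Δ - φ i) = 0 := by
            rcases Nat.even_or_odd k with h | h
            · rw [if_pos h]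
              by_contra h'
              exact hprod ⟨fun _ => h', fun h2 => absurd h (Nat.not_even_iff_odd.2 h2)⟩
            · rw [if_neg (Nat.not_even_iff_odd.2 h)]
              by_contra h'
              exact hprod ⟨fun h2 => absurd h2 (Nat.not_even_iff_odd.2 h),
                fun _ h3 => h' (by rw [h3, sub_self])⟩
          rw [hend] at htk
          cases k with
          | zero => simp at htk; linarith
          | succ k =>
            refine hsucc i k _ (ih hs i k ?_ (by linarith))
            have hΔ' : (if Even k then φ i else Δ - φ i) = Δ := by
              rcases Nat.even_or_odd k with h | h
              · have h1 : ¬ Even (k + 1) := by simpa [Nat.even_add_one] using h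
                rw [if_neg h1] at hend
                rw [if_pos h]; linarith
              · rw [if_pos h.add_one] at hend
                rw [if_neg (Nat.not_even_iff_odd.2 h)]; linarith
            rw [hΔ']
            push_cast at htk
            linarith

/-! ### The hard objective -/

section Hard

variable {m d n : ℕ}

/-- The links held by agent `i`: the odd ones for `i ∈ A`, the even ones for `i ∈ B`. -/
def heldLinks (A B : Finset (Fin m)) (n : ℕ) (i : Fin m) : Finset ℕ :=
  {j ∈ Finset.range n | i ∈ A ∧ Odd j ∨ i ∈ B ∧ Even j}

/-- The hard objective: agents in `A` hold the odd links of a chain together with a linear term that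
pulls the first coordinate, agents in `B` hold the even links, and all others hold zero. The total
is minimal where all links have the value `δ`. -/
noncomputable def chainObjective (A B : Finset (Fin m)) (n : ℕ) (e : ℕ → EuclideanSpace ℝ (Fin d))
    (L δ : ℝ) (i : Fin m) : EuclideanSpace ℝ (Fin d) → ℝ :=
  dirQuadratic L (link e) (heldLinks A B n i) ((if i ∈ A then L * δ / 2 else 0) • e 0)

/-- The consensus solution of `chainObjective`. -/
noncomputable def chainSolution (m : ℕ) (n : ℕ) (e : ℕ → EuclideanSpace ℝ (Fin d)) (δ : ℝ) :
    Stack m d :=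
  WithLp.toLp 2 fun _ => chainPoint e n δ

variable {A B : Finset (Fin m)} {e : ℕ → EuclideanSpace ℝ (Fin d)} {L δ : ℝ}

theorem mem_heldLinks {i : Fin m} {j : ℕ} :
    j ∈ heldLinks A B n i ↔ j < n ∧ (i ∈ A ∧ Odd j ∨ i ∈ B ∧ Even j) := by
  simp [heldLinks]

theorem chainObjective_convex (hL : 0 ≤ L) (i : Fin m) :
    ConvexOn ℝ Set.univ (chainObjective A B n e L δ i) :=
  convexOn_dirQuadratic _ _ _ _ hL

theorem chainObjective_smooth (he : IsChainBasis n e) (hAB : Disjoint A B) (hL : 0 ≤ L)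
    (i : Fin m) : IsSmoothWith L (chainObjective A B n e L δ i) := by
  refine ⟨fun x => (hasGradientAt_dirQuadratic _ _ _ _ x).differentiableAt, fun x y => ?_⟩
  rw [chainObjective, gradient_dirQuadratic, gradient_dirQuadratic]
  refine norm_dirQuadraticGrad_sub_le _ _ hL (fun j hj l hl hjl => ?_)
    (fun j _ => he.inner_link_self_le j) x y
  have hpar : j % 2 = l % 2 := by
    obtain ⟨-, hj⟩ := mem_heldLinks.1 hj
    obtain ⟨-, hl⟩ := mem_heldLinks.1 hl
    have hdis : i ∈ A → i ∉ B := fun h h' => Finset.disjoint_left.1 hAB h h'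
    simp only [Nat.odd_iff, Nat.even_iff] at hj hl
    rcases hj with hj | hj <;> rcases hl with hl | hl
    · omega
    · exact absurd hl.1 (hdis hj.1)
    · exact absurd hj.1 (hdis hl.1)
    · omega
  exact he.inner_link_of_ne hjl (by omega) (by omega)

theorem gradient_chainObjective (i : Fin m) (x : EuclideanSpace ℝ (Fin d)) :
    ∇ (chainObjective A B n e L δ i) x = dirQuadraticGrad L (link e) (heldLinks A B n i)
      ((if i ∈ A then L * δ / 2 else 0) • e 0) x :=
  gradient_dirQuadratic _ _ _ _ x

/-- At the solution the gradients of the agents in `A` and in `B` are opposite. -/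
theorem gradient_chainObjective_chainPoint (he : IsChainBasis n e) (hAB : Disjoint A B)
    (i : Fin m) :
    ∇ (chainObjective A B n e L δ i) (chainPoint e n δ) =
      ((if i ∈ B then L * δ / 2 else 0) - (if i ∈ A then L * δ / 2 else 0)) •
        ∑ j ∈ Finset.range n, (-1 : ℝ) ^ j • e j := by
  rw [gradient_chainObjective, dirQuadraticGrad,
    Finset.sum_congr rfl (g := fun j => δ • link e j) (fun j hj => by
      rw [he.inner_link_chainPoint δ (mem_heldLinks.1 hj).1]), ← Finset.smul_sum, smul_smul,
    (by ring : L / 2 * δ = L * δ / 2)]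
  by_cases hA : i ∈ A
  · have hB : i ∉ B := Finset.disjoint_left.1 hAB hA
    have : heldLinks A B n i = {j ∈ Finset.range n | Odd j} := by
      ext j; simp [heldLinks, hA, hB]
    rw [this, he.sum_link_odd, if_pos hA, if_neg hB, smul_sub]
    simp
  · by_cases hB : i ∈ B
    · have : heldLinks A B n i = {j ∈ Finset.range n | Even j} := by
        ext j; simp [heldLinks, hA, hB]
      rw [this, he.sum_link_even, if_neg hA, if_pos hB]
      simp
    · have : heldLinks A B n i = ∅ := by
        ext j; simp [heldLinks, hA, hB]
      simp [this, hA, hB]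

theorem norm_sq_stackGradient_chainObjective (he : IsChainBasis n e) (hAB : Disjoint A B)
    {K : ℕ} (hA : A.card = K) (hB : B.card = K) :
    ‖stackGradient (chainObjective A B n e L δ) (chainSolution m n e δ)‖ ^ 2 =
      2 * K * n * (L * δ / 2) ^ 2 := by
  have hs : ‖∑ j ∈ Finset.range n, (-1 : ℝ) ^ j • e j‖ ^ 2 = n := by
    rw [he.norm_sq_sum_smul]
    simp [← pow_mul, mul_comm _ 2]
  have hrow : ∀ i, ‖stackGradient (chainObjective A B n e L δ) (chainSolution m n e δ) i‖ ^ 2 =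
      (if i ∈ A then (L * δ / 2) ^ 2 * n else 0) + if i ∈ B then (L * δ / 2) ^ 2 * n else 0 := by
    intro i
    have h1 : stackGradient (chainObjective A B n e L δ) (chainSolution m n e δ) i =
      ∇ (chainObjective A B n e L δ i) (chainPoint e n δ) := rfl
    rw [h1, gradient_chainObjective_chainPoint he hAB, norm_smul, mul_pow, hs, Real.norm_eq_abs,
      sq_abs]
    have hdis : i ∈ A → i ∉ B := fun h h' => Finset.disjoint_left.1 hAB h h'
    by_cases h : i ∈ A
    · simp [h, hdis h]
    · by_cases h' : i ∈ B <;> simp [h, h']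
  rw [PiLp.norm_sq_eq_of_L2, Finset.sum_congr rfl fun i _ => hrow i, Finset.sum_add_distrib,
    Finset.sum_ite_mem, Finset.sum_ite_mem, Finset.univ_inter, Finset.univ_inter,
    Finset.sum_const, Finset.sum_const, hA, hB, nsmul_eq_mul]
  ring

theorem norm_sq_chainSolution (he : IsChainBasis n e) :
    ‖chainSolution m n e δ‖ ^ 2 = m * (δ ^ 2 * (n * (n + 1) * (2 * n + 1) / 6)) := by
  rw [PiLp.norm_sq_eq_of_L2, ← he.norm_sq_chainPoint]
  simp [chainSolution]

theorem bregman_chainObjective (x : Stack m d) :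
    bregman (chainObjective A B n e L δ) x (chainSolution m n e δ) =
      L / 4 * ∑ i, ∑ j ∈ heldLinks A B n i,
        inner ℝ (link e j) (x i - chainPoint e n δ) ^ 2 := by
  have h := fun i => dirQuadratic_bregman L (link e) (heldLinks A B n i)
    ((if i ∈ A then L * δ / 2 else 0) • e 0) (x i) (chainPoint e n δ)
  rw [Finset.mul_sum, ← Finset.sum_congr rfl fun i _ => h i]
  simp only [bregman, stackObjective, PiLp.inner_apply, ← Finset.sum_sub_distrib]
  refine Finset.sum_congr rfl fun i _ => ?_
  rw [← gradient_chainObjective]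
  rfl

/-- All link values of the solution are `δ`, so a stack with vanishing coordinates from the `k`-th
on misses the value of `n - k` links, each at all agents holding it. -/
theorem le_bregman_chainObjective (he : IsChainBasis n e) (hL : 0 ≤ L)
    {K : ℕ} (hA : A.card = K) (hB : B.card = K) {k : ℕ} (hk : k ≤ n) {x : Stack m d}
    (hx : ∀ i, x i ∈ chainHead e k) :
    L / 4 * (((n : ℝ) - k) * (K * δ ^ 2)) ≤
      bregman (chainObjective A B n e L δ) x (chainSolution m n e δ) := by
  rw [bregman_chainObjective]
  refine mul_le_mul_of_nonneg_left ?_ (by positivity)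
  simp only [heldLinks, Finset.sum_filter]
  rw [Finset.sum_comm]
  have hsub : Finset.Ico k n ⊆ Finset.range n := fun j hj =>
    Finset.mem_range.2 (Finset.mem_Ico.1 hj).2
  refine le_trans ?_ (Finset.sum_le_sum_of_subset_of_nonneg hsub fun j _ _ =>
    Finset.sum_nonneg fun i _ => by split_ifs <;> positivity)
  have hcard : ((n : ℝ) - k) * (K * δ ^ 2) = ∑ _j ∈ Finset.Ico k n, (K * δ ^ 2) := by
    rw [Finset.sum_const, Nat.card_Ico, nsmul_eq_mul, Nat.cast_sub hk]
  rw [hcard]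
  refine Finset.sum_le_sum fun j hj => ?_
  obtain ⟨hkj, hjn⟩ := Finset.mem_Ico.1 hj
  have hval : ∀ i, inner ℝ (link e j) (x i - chainPoint e n δ) ^ 2 = δ ^ 2 := fun i => by
    rw [inner_sub_right, he.inner_link_chainPoint δ hjn, link, inner_sub_left, hx i j hkj,
      hx i (j + 1) (by omega)]
    ring
  simp only [hval]
  rw [← Finset.sum_filter, Finset.sum_const, nsmul_eq_mul]
  refine mul_le_mul_of_nonneg_right (Nat.cast_le.2 ?_) (sq_nonneg δ)
  rcases Nat.even_or_odd j with h | h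
  · rw [← hB]
    exact Finset.card_le_card fun i hi => by simp [hi, h]
  · rw [← hA]
    exact Finset.card_le_card fun i hi => by simp [hi, h]

theorem isConsensusSolution_chainSolution (he : IsChainBasis n e) (hAB : Disjoint A B)
    (hL : 0 ≤ L) {K : ℕ} (hA : A.card = K) (hB : B.card = K) :
    IsConsensusSolution (chainObjective A B n e L δ) (chainSolution m n e δ) := by
  refine ⟨⟨chainPoint e n δ, fun _ => rfl⟩, ?_⟩
  rintro z ⟨v, hv⟩
  have hb : 0 ≤ bregman (chainObjective A B n e L δ) z (chainSolution m n e δ) := by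
    rw [bregman_chainObjective]
    positivity
  -- the local gradients at the solution add up to zero, so the linear term of the Bregman
  -- distance vanishes along the consensus space
  have hgrad : inner ℝ (stackGradient (chainObjective A B n e L δ) (chainSolution m n e δ))
      (z - chainSolution m n e δ) = 0 := by
    rw [PiLp.inner_apply]
    have : ∀ i, inner ℝ (stackGradient (chainObjective A B n e L δ) (chainSolution m n e δ) i)
        ((z - chainSolution m n e δ) i) =
        ((if i ∈ B then L * δ / 2 else 0) - (if i ∈ A then L * δ / 2 else 0)) *
        inner ℝ (∑ j ∈ Finset.range n, (-1 : ℝ) ^ j • e j) (v - chainPoint e n δ) := fun i => by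
      have h1 : stackGradient (chainObjective A B n e L δ) (chainSolution m n e δ) i =
        ∇ (chainObjective A B n e L δ i) (chainPoint e n δ) := rfl
      rw [h1, gradient_chainObjective_chainPoint he hAB, inner_smul_left, RCLike.conj_to_real,
        ← hv i]
      rfl
    rw [Finset.sum_congr rfl fun i _ => this i, ← Finset.sum_mul, Finset.sum_sub_distrib,
      Finset.sum_ite_mem, Finset.sum_ite_mem, Finset.univ_inter, Finset.univ_inter,
      Finset.sum_const, Finset.sum_const, hA, hB, sub_self, zero_mul]
  rw [bregman, hgrad] at hb
  linarith

/-- Until time `(k + 1) + k Δ τ` every agent only knows the first `k` chain coordinates. -/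
theorem FirstOrderOracle.mem_chainHead (he : IsChainBasis n e) {𝒢 : SimpleGraph (Fin m)} {τ : ℝ}
    {x : ℝ → Stack m d} (hx : FirstOrderOracle 𝒢 τ (chainObjective A B n e L δ) x) (hτ : 0 < τ)
    {φ : Fin m → ℝ} {Δ : ℝ} (hφ : ∀ i j, 𝒢.Adj i j → |φ i - φ j| ≤ 1)
    (h0 : ∀ i, 0 ≤ φ i) (hΔ : ∀ i, φ i ≤ Δ) (hA : ∀ i ∈ A, φ i = 0) (hB : ∀ i ∈ B, φ i = Δ)
    {t : ℝ} (ht : 0 ≤ t) {k : ℕ} (htk : t ≤ (k + 1) + k * (Δ * τ)) (i : Fin m) :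
    x t i ∈ chainHead e k := by
  refine hx.mem_of_le hτ hφ (Δ := Δ) (S := chainHead e) ?_ ?_ ht i k ?_
  · intro i k v hv
    rw [gradient_chainObjective]
    exact dirQuadraticGrad_mem_chainHead_succ he hv
  · intro i k v hv hev hodd
    rw [gradient_chainObjective]
    refine dirQuadraticGrad_mem_chainHead he hv (fun j hj hjk => ?_) (fun hk => ?_)
    · rcases (mem_heldLinks.1 hj).2 with ⟨hi, hj'⟩ | ⟨hi, hj'⟩
      · exact hev (hjk ▸ hj'.add_one) (hA i hi)
      · exact hodd (hjk ▸ hj'.add_one) (hB i hi)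
    · rw [if_neg]
      exact fun hi => hev (hk ▸ Even.zero) (hA i hi)
  · have : 0 ≤ (if Even k then φ i else Δ - φ i) * τ := by
      refine mul_nonneg ?_ hτ.le
      split_ifs
      · exact h0 i
      · linarith [hΔ i]
    linarith

/-- The size of the gradient `g` at the solution, where `Q = √(L R² / ε)` and
`g = L R / √p` with `p = (n + 1) (2 n + 1)`. -/
theorem div_bounds_of_sq {Q g L R ε p : ℝ} (hε : 0 < ε) (hL : 0 < L) (hR : 0 < R) (hQ : 0 < Q)
    (hg : 0 ≤ g) (hQε : Q ^ 2 * ε = L * R ^ 2) (hgp : g ^ 2 * p = (L * R) ^ 2) (hp : p ≤ Q ^ 2)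
    (hp' : Q ^ 2 ≤ 64 * p) : Q ≤ R * g / ε ∧ R * g / ε ≤ 8 * Q := by
  have h1 : L * R ≤ g * Q := by
    refine le_of_sq_le_sq ?_ (by positivity)
    rw [← hgp, mul_pow]
    exact mul_le_mul_of_nonneg_left hp (by positivity)
  have h2 : g * Q ≤ 8 * (L * R) := by
    refine le_of_sq_le_sq ?_ (by positivity)
    rw [mul_pow, mul_pow, ← hgp]
    linarith [mul_le_mul_of_nonneg_left hp' (sq_nonneg g)]
  rw [le_div_iff₀ hε, div_le_iff₀ hε]
  have h1' := mul_le_mul_of_nonneg_left h1 hR.le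
  have h2' := mul_le_mul_of_nonneg_left h2 hR.le
  constructor
  · refine le_of_mul_le_mul_left ?_ hQ
    linarith [(by ring : Q * (Q * ε) = Q ^ 2 * ε)]
  · refine le_of_mul_le_mul_left ?_ hQ
    linarith [(by ring : Q * (8 * Q * ε) = 8 * (Q ^ 2 * ε))]

/-- The lower bound for a general graph: `A` and `B` are sets of a third of the agents each, and `φ`
shows that they are at distance at least `Δ`. The chain has `n ≈ √(L R² / ε) / 5` links. -/
theorem exists_hard_objective {𝒢 : SimpleGraph (Fin m)} {φ : Fin m → ℝ} {Δ : ℝ} {K : ℕ}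
    (hK : 0 < K) (hm : m = 3 * K) (hA : A.card = K) (hB : B.card = K)
    (hφ : ∀ i j, 𝒢.Adj i j → |φ i - φ j| ≤ 1) (h0 : ∀ i, 0 ≤ φ i) (hΔ : ∀ i, φ i ≤ Δ)
    (hΔ0 : 0 < Δ) (hφA : ∀ i ∈ A, φ i = 0) (hφB : ∀ i ∈ B, φ i = Δ)
    {Lf R τ ε : ℝ} (hL : 0 < Lf) (hR : 0 < R) (hτ : 0 < τ) (hε : 0 < ε)
    (hε' : ε ≤ 1 / 100 * (Lf * R ^ 2)) (hd : √(Lf * R ^ 2 / ε) ≤ d) :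
    ∃ (f : Fin m → EuclideanSpace ℝ (Fin d) → ℝ) (xstar : Stack m d),
      (∀ i, ConvexOn ℝ Set.univ (f i) ∧ IsSmoothWith Lf (f i)) ∧
      IsConsensusSolution f xstar ∧ ‖(0 : Stack m d) - xstar‖ = R ∧
      (∀ x : ℝ → Stack m d, FirstOrderOracle 𝒢 τ f x → ∀ t : ℝ, 0 ≤ t →
        bregman f (x t) xstar ≤ ε → 1 / 40 * ((1 + Δ * τ) * √(Lf * R ^ 2 / ε)) ≤ t) ∧
      √(Lf * R ^ 2 / ε) ≤ R * ‖stackGradient f xstar‖ / ε ∧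
      R * ‖stackGradient f xstar‖ / ε ≤ 8 * √(Lf * R ^ 2 / ε) := by
  have hAB : Disjoint A B := Finset.disjoint_left.2 fun i hi hi' => by
    have := hφA i hi; have := hφB i hi'; linarith
  set Q := √(Lf * R ^ 2 / ε) with hQ
  have hQsq : Q ^ 2 = Lf * R ^ 2 / ε := Real.sq_sqrt (by positivity)
  have hQε : Q ^ 2 * ε = Lf * R ^ 2 := by rw [hQsq]; field_simp
  have hQ10 : 10 ≤ Q := by
    refine Real.le_sqrt_of_sq_le ?_
    rw [le_div_iff₀ hε]; linarith
  -- the number of links, small enough that `4 (n + 1) (2 n + 1) < Q²`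
  set n := ⌊Q / 5⌋₊ with hn
  have hn1 : (n : ℝ) ≤ Q / 5 := Nat.floor_le (by positivity)
  have hn2 : Q / 5 < n + 1 := Nat.lt_floor_add_one _
  have hn0 : 2 ≤ n := Nat.le_floor (by push_cast; linarith)
  have hn0' : (2 : ℝ) ≤ n := by exact_mod_cast hn0
  have hn10 : Q ≤ 10 * n := by linarith
  have hnd : n ≤ d := by
    have : (n : ℝ) ≤ d := by linarith
    exact_mod_cast this
  obtain ⟨e, he⟩ := exists_isChainBasis hnd
  have hK' : (0 : ℝ) < K := by exact_mod_cast hK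
  have hmR : (m : ℝ) = 3 * K := by rw [hm]; push_cast; ring
  set D : ℝ := n * (n + 1) * (2 * n + 1) with hD
  have hDpos : 0 < D := by positivity
  -- the value of a link for which the solution has norm `R`
  set δ := √(2 * R ^ 2 / (K * D)) with hδ
  have hδsq : K * δ ^ 2 * D = 2 * R ^ 2 := by
    rw [hδ, Real.sq_sqrt (by positivity)]; field_simp
  have hgradsq : ‖stackGradient (chainObjective A B n e Lf δ) (chainSolution m n e δ)‖ ^ 2 *
      ((n + 1) * (2 * n + 1)) = (Lf * R) ^ 2 := by
    rw [norm_sq_stackGradient_chainObjective he hAB hA hB]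
    have : 2 * (K : ℝ) * n * (Lf * δ / 2) ^ 2 * ((n + 1) * (2 * n + 1)) =
      Lf ^ 2 / 2 * (K * δ ^ 2 * D) := by rw [hD]; ring
    rw [this, hδsq]; ring
  set g := ‖stackGradient (chainObjective A B n e Lf δ) (chainSolution m n e δ)‖ with hg
  have hg0 : 0 ≤ g := norm_nonneg _
  have hp1 : ((n : ℝ) + 1) * (2 * n + 1) ≤ Q ^ 2 := by
    have h1 : ((n : ℝ) + 1) * (2 * n + 1) ≤ Q * Q :=
      mul_le_mul (by linarith) (by linarith) (by positivity) (by linarith)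
    rwa [sq]
  have hp2 : Q ^ 2 ≤ 64 * (((n : ℝ) + 1) * (2 * n + 1)) := by
    have h1 : Q * Q ≤ (8 * ((n : ℝ) + 1)) * (8 * (2 * n + 1)) :=
      mul_le_mul (by linarith) (by linarith) (by linarith) (by positivity)
    linarith [sq Q]
  refine ⟨chainObjective A B n e Lf δ, chainSolution m n e δ,
    fun i => ⟨chainObjective_convex hL.le i, chainObjective_smooth he hAB hL.le i⟩,
    isConsensusSolution_chainSolution he hAB hL.le hA hB, ?_, ?_,
    div_bounds_of_sq hε hL hR (by linarith) hg0 hQε hgradsq hp1 hp2⟩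
  · rw [zero_sub, norm_neg, ← abs_of_nonneg (norm_nonneg (chainSolution m n e δ)),
      ← abs_of_pos hR, ← sq_eq_sq_iff_abs_eq_abs, norm_sq_chainSolution he, hmR]
    linear_combination (1 / 2) * hδsq
  · intro x hx t ht hb
    set k := n / 2 with hk
    have hkn : (2 : ℝ) * k ≤ n := by exact_mod_cast (by omega : 2 * k ≤ n)
    have hk4 : (n : ℝ) ≤ 4 * k := by exact_mod_cast (by omega : n ≤ 4 * k)
    have hlt : (k + 1 : ℝ) + k * (Δ * τ) < t := by
      by_contra! hle
      have h1 := le_bregman_chainObjective he hL.le hA hB (δ := δ) (k := k) (by omega)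
        (hx.mem_chainHead he hτ hφ h0 hΔ hφA hφB ht hle)
      have h2 : Lf / 4 * (((n : ℝ) - k) * (K * δ ^ 2)) ≤ ε := h1.trans hb
      -- multiply by `D` to clear the denominator of `δ²`
      have h3 : Lf / 4 * (((n : ℝ) - k) * (K * δ ^ 2)) * D = Lf * R ^ 2 / 2 * (n - k) := by
        linear_combination (Lf / 4 * ((n : ℝ) - k)) * hδsq
      have h4 : Lf * R ^ 2 / 2 * (n - k) ≤ ε * D :=
        h3 ▸ mul_le_mul_of_nonneg_right h2 hDpos.le
      have h5 : Lf * R ^ 2 / 2 * ((n : ℝ) / 2) ≤ ε * D :=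
        (mul_le_mul_of_nonneg_left (by linarith) (by positivity)).trans h4
      rw [← hQε] at h5
      have h6 : Q ^ 2 * (n * ε) ≤ 4 * ((n + 1) * (2 * n + 1)) * (n * ε) := by
        rw [hD] at h5; linarith
      have h7 := le_of_mul_le_mul_right h6 (by positivity)
      have h8 : 4 * (((n : ℝ) + 1) * (2 * n + 1)) < 25 * (n * n) := by nlinarith
      have h9 : 5 * (n : ℝ) * (5 * n) ≤ Q * Q :=
        mul_le_mul (by linarith) (by linarith) (by positivity) (by linarith)
      linarith [sq Q]
    have h1 : 0 ≤ Δ * τ := by positivity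
    have h2 : 1 / 40 * Q ≤ k := by linarith
    linarith [mul_le_mul_of_nonneg_right h2 h1]
end Hard

/-! ### The lower bound on the squared path -/

/-- The distance of a node of the squared path with `3 (K + 1)` nodes from the first third, measured
in steps of length two and capped at `(K + 2) / 2`, the value on the last third. -/
noncomputable def pathPotential (K : ℕ) (i : Fin (3 * K + 2 + 1)) : ℝ :=
  min (max (((i : ℝ) - K) / 2) 0) ((K + 2) / 2)

theorem abs_pathPotential_sub_le (K : ℕ) {i j : Fin (3 * K + 2 + 1)}
    (h : (squaredPath (3 * K + 2 + 1)).Adj i j) :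
    |pathPotential K i - pathPotential K j| ≤ 1 := by
  obtain ⟨-, h1, h2⟩ := h
  have h1' : (i : ℝ) ≤ j + 2 := by exact_mod_cast h1
  have h2' : (j : ℝ) ≤ i + 2 := by exact_mod_cast h2
  refine (abs_min_sub_min_le_max _ _ _ _).trans (max_le ?_ (by simp))
  refine (abs_max_sub_max_le_max _ _ _ _).trans (max_le ?_ (by simp))
  rw [abs_le]
  constructor <;> linarith

end DecentralizedOpt

theorem mainTheorem2 :
    ∃ c₀ c C : ℝ, 0 < c₀ ∧ 0 < c ∧ 0 < C ∧
      ∀ η : ℝ, 0 < η → η ≤ 1 →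
      ∃ (m : ℕ) (hm : 2 ≤ m) (𝒢 : SimpleGraph (Fin m)) (Λ : Matrix (Fin m) (Fin m) ℝ)
        (hΛ : IsGossipMatrix 𝒢 Λ),
        𝒢.Connected ∧ eigengap hm hΛ.posSemidef.isHermitian = η ∧
        ∀ (Lf R τc ε : ℝ) (d : ℕ), 0 < Lf → 0 < R → 0 < τc → 0 < ε →
          ε ≤ c₀ * (Lf * R ^ 2) → √(Lf * R ^ 2 / ε) ≤ d →
          ∃ (f : Fin m → EuclideanSpace ℝ (Fin d) → ℝ) (xstar : Stack m d),
            (∀ i, ConvexOn ℝ Set.univ (f i) ∧ IsSmoothWith Lf (f i)) ∧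
            IsConsensusSolution f xstar ∧
            ‖(0 : Stack m d) - xstar‖ = R ∧
            (∀ x : ℝ → Stack m d, FirstOrderOracle 𝒢 τc f x →
              ∀ t : ℝ, 0 ≤ t → bregman f (x t) xstar ≤ ε →
                c * ((1 + τc / √η) *
                  (√(Lf * R ^ 2 / ε) + R * ‖stackGradient f xstar‖ / ε)) ≤ t ∧
                c * ((1 + τc / √η) * √(Lf * R ^ 2 / ε)) ≤ t) ∧
            c * √(Lf * R ^ 2 / ε) ≤ R * ‖stackGradient f xstar‖ / ε ∧
            R * ‖stackGradient f xstar‖ / ε ≤ C * √(Lf * R ^ 2 / ε) := by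
  -- `144000 = 40 * 400 * 9`: the constants of the time bound, of the comparison of `1 / √η` with
  -- the distance, and of the sum of both terms, the second being at most `8` times the first
  refine ⟨1 / 100, 1 / 144000, 8, by norm_num, by norm_num, by norm_num, fun η hη hη1 => ?_⟩
  obtain ⟨K, Λ, hΛ, hgap, hK⟩ := exists_gossipMatrix_eigengap_eq hη hη1
  refine ⟨3 * K + 2 + 1, by omega, squaredPath (3 * K + 2 + 1), Λ, hΛ, squaredPath_connected _,
    hgap, fun Lf R τc ε d hL hR hτ hε hε' hd => ?_⟩
  set Δ : ℝ := (K + 2) / 2 with hΔ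
  have hΔ0 : 0 < Δ := by positivity
  obtain ⟨f, xstar, hf, hsol, hnorm, htime, hlow, hup⟩ :=
    exists_hard_objective (𝒢 := squaredPath (3 * K + 2 + 1)) (φ := pathPotential K) (Δ := Δ)
      (A := Finset.Iic ⟨K, by omega⟩) (B := Finset.Ici ⟨2 * K + 2, by omega⟩)
      (Nat.succ_pos K) (by omega) (Fin.card_Iic _) (by rw [Fin.card_Ici]; simp only; omega)
      (fun i j h => abs_pathPotential_sub_le K h)
      (fun i => le_min (le_max_right _ _) hΔ0.le) (fun i => min_le_right _ _) hΔ0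
      (fun i hi => by
        have h : (i : ℝ) ≤ K := by exact_mod_cast (Fin.le_def.1 (Finset.mem_Iic.1 hi))
        rw [pathPotential, max_eq_right (by linarith), min_eq_left hΔ0.le])
      (fun i hi => by
        have h : (2 : ℝ) * K + 2 ≤ i := by
          exact_mod_cast (Fin.le_def.1 (Finset.mem_Ici.1 hi))
        rw [pathPotential, min_eq_right]
        exact le_max_of_le_left (by linarith))
      hL hR hτ hε hε' hd
  have hs : 0 < √η := Real.sqrt_pos.2 hη
  set Q := √(Lf * R ^ 2 / ε)
  have hQ : 0 ≤ Q := Real.sqrt_nonneg _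
  -- `1 / √η` is at most a constant times the distance `Δ`
  have hspeed : 1 + τc / √η ≤ 400 * (1 + Δ * τc) := by
    have h1 : τc / √η ≤ 400 * Δ * τc := by
      rw [div_le_iff₀ hs]
      have h2 : 1 ≤ √η * (400 * Δ) := by
        rw [hΔ]; linarith
      linarith [mul_le_mul_of_nonneg_left h2 hτ.le]
    linarith
  have hmul := mul_le_mul_of_nonneg_right hspeed hQ
  have hspeed0 : 0 ≤ 1 + τc / √η := by positivity
  refine ⟨f, xstar, hf, hsol, hnorm, fun x hx t ht hb => ?_, by linarith, hup⟩
  have h1 := htime x hx t ht hb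
  have h2 : 0 ≤ (1 + τc / √η) * Q := mul_nonneg hspeed0 hQ
  constructor
  · have h3 := mul_le_mul_of_nonneg_left hup hspeed0
    rw [mul_add]
    linarith
  · linarith
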